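/- Let $\rho_0,\rho_1,\rho_2$ be Borel probability measures on $\mathbb{R}^d$ with finite second moments, let $t,s\ge 0$ with $t+s\le 1$, and put $\lambda=(\lambda_0,\lambda_1,\lambda_2)=(1-t-s,t,s)$. An optimal transport map $T:\mu\to\nu$ is a map with $T_\#\mu=\nu$ and $\int\|x-T(x)\|^2\,d\mu(x)=W_2^2(\mu,\nu)$. A family $(T_i)_{i\in I}$ of maps is an admissible family of deformations of a Borel set $\Omega\subset\mathbb{R}^d$ (with $\rho_0(\Omega)=1$) if one of the $T_i$ is the identity on $\Omega$, every $T_i$ is one-to-one from $\Omega$ onto $\Omega$, and for all $i,j$ the map $T_i\circ T_j^{-1}$ is an optimal transport map from $(T_j)_\#\rho_0$ to $(T_i)_\#\rho_0$. Suppose that $T_1:\rho_0\to\rho_1$ and $T_2:\rho_0\to\rho_2$ are optimal transport maps which belong to an admissible family of deformations, and let $$z_{t,s}(a)=(1-t-s)\,a+t\,T_1(a)+s\,T_2(a),\qquad \hat\rho_{t,s}=(z_{t,s})_\#\rho_0 .$$ For $\sigma>0$ consider path-independent flow matching (PiFM) with conditional densities $p^\sigma_{t,s}(x\mid a)=\mathcal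 N(x\mid z_{t,s}(a),\sigma^2 I)$ and conditional vector fields $T_1(a)-a$ (in $t$) and $T_2(a)-a$ (in $s$), that is, with marginal density $p^\sigma_{t,s}(x)=\int p^\sigma_{t,s}(x\mid a)\,d\rho_0(a)$ and marginal vector fields $$u^\sigma_{t,s}(x)=\int (T_1(a)-a)\frac{p^\sigma_{t,s}(x\mid a)}{p^\sigma_{t,s}(x)}\,d\rho_0(a),\qquad v^\sigma_{t,s}(x)=\int (T_2(a)-a)\frac{p^\sigma_{t,s}(x\mid a)}{p^\sigma_{t,s}(x)}\,d\rho_0(a).$$ Let $\Phi^\sigma,\Psi^\sigma$ be flow maps of these fields for parameters in $[0,1]^2$, i.e. $\partial_t\Phi^\sigma_{t,s}=u^\sigma_{t,s}(\Phi^\sigma_{t,s})$ and $\partial_s\Psi^\sigma_{t,s}=v^\sigma_{t,s}(\Psi^\sigma_{t,s})$ from almost every starting point, with $\Phi^\sigma_{0,0}=\Psi^\sigma_{0,0}=\mathrm{Id}$, $\Phi^\sigma_{0,s}=\Psi^\sigma_{0,s}$ and $\Psi^\sigma_{t,0}=\Phi^\sigma_{t,0}$. Then: 1. For every $\sigma>0$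 and all such flow maps, $(\Phi^\sigma_{t,s})_\#p^\sigma_{0,0}=(\Psi^\sigma_{t,s})_\#p^\sigma_{0,0}=p^\sigma_{t,s}$. As $\sigma\to0^+$, $p^\sigma_{0,0}\to\rho_0$ and $p^\sigma_{t,s}\to\hat\rho_{t,s}$ weakly. 2. $\hat\rho_{t,s}$ is a Wasserstein barycenter of $(\rho_0,\rho_1,\rho_2)$ with weights $\lambda$: it minimizes $\nu\mapsto\sum_{j}\lambda_jW_2^2(\rho_j,\nu)$ among the probability measures with finite second moment, and it is the image under $(x_0,x_1,x_2)\mapsto\sum_j\lambda_jx_j$ of a coupling $\gamma$ of $\rho_0,\rho_1,\rho_2$ which minimizes the multi-marginal cost $$J(\gamma,\lambda)=\int\sum_{j=0}^2\lambda_j\Big\|\sum_{i=0}^2\lambda_ix_i-x_j\Big\|^2\,d\gamma(x_0,x_1,x_2).$$ If some $\rho_j$ with $\lambda_j>0$ is absolutely continuous with respect to the Lebesgue measure, then $\hat\rho_{t,s}$ is the only Wasserstein barycenter, in either description. 3. The minimum of $J(\gamma,\lambda)$ over all couplings $\gamma$ of $\rho_0,\rho_1,\rho_2$ is attained, and it is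 the (finite) number $$\int\Big[(1-t-s)\|z_{t,s}(a)-a\|^2+t\,\|z_{t,s}(a)-T_1(a)\|^2+s\,\|z_{t,s}(a)-T_2(a)\|^2\Big]\,d\rho_0(a).$$ -/

import Mathlib

open MeasureTheory Set Filter Topology
open scoped ENNReal BoundedContinuousFunction

noncomputable section

namespace PiFM

/-- The Euclidean space `ℝᵈ`. -/
abbrev E (d : ℕ) : Type := EuclideanSpace ℝ (Fin d)

/-! ### Optimal transport -/

/-- The squared 2-Wasserstein distance: the infimum of the quadratic cost over all couplings. -/
def W2sq {d : ℕ} (μ ν : Measure (E d)) : ℝ≥0∞ :=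
  ⨅ π ∈ {π : Measure (E d × E d) | π.map Prod.fst = μ ∧ π.map Prod.snd = ν},
    ∫⁻ p, edist p.1 p.2 ^ 2 ∂π

/-- `T` is an optimal transport map from `μ` to `ν` for the quadratic cost: it pushes `μ` forward
to `ν`, and the coupling `(id, T)_# μ` that it induces has the least cost among all couplings. -/
structure IsOptimalTransportMap {d : ℕ} (T : E d → E d) (μ ν : Measure (E d)) : Prop where
  aemeasurable : AEMeasurable T μ
  map_eq : μ.map T = ν
  cost_eq : ∫⁻ x, edist x (T x) ^ 2 ∂μ = W2sq μ ν

/-- The family `(T j)` of maps is an admissible family of deformations of `Ω` (with respect to a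
reference measure `μ` carried by `Ω`): one of the maps is the identity, every `T j` is a one-to-one
map of `Ω` onto `Ω`, and every composition `T i ∘ (T j)⁻¹` is again an optimal transport map
(between the deformed measures `(T j)_# μ` and `(T i)_# μ`). -/
structure IsAdmissibleFamily {d : ℕ} {ι : Type*} (μ : Measure (E d)) (Ω : Set (E d))
    (T : ι → E d → E d) : Prop where
  aemeasurable : ∀ j, AEMeasurable (T j) μ
  exists_id : ∃ j₀, EqOn (T j₀) id Ω
  bijOn : ∀ j, BijOn (T j) Ω Ω
  optimal : ∀ i j, IsOptimalTransportMap (T i ∘ Function.invFunOn (T j) Ω)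
    (μ.map (T j)) (μ.map (T i))

/-! ### Wasserstein barycenters and multi-marginal optimal transport -/

/-- The weighted sum of squared Wasserstein distances `∑ j, w j * W₂(μ j, ν)²`. -/
def barycenterObjective {d : ℕ} {ι : Type*} [Fintype ι] (w : ι → ℝ) (μ : ι → Measure (E d))
    (ν : Measure (E d)) : ℝ≥0∞ :=
  ∑ j, ENNReal.ofReal (w j) * W2sq (μ j) ν

/-- `ν` is a Wasserstein barycenter of the `μ j` with weights `w j`: it minimizes
`∑ j, w j * W₂(μ j, ·)²` among the probability measures with finite second moment. -/
structure IsWassersteinBarycenter {d : ℕ} {ι : Type*} [Fintype ι] (w : ι → ℝ)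
    (μ : ι → Measure (E d)) (ν : Measure (E d)) : Prop where
  isProbabilityMeasure : IsProbabilityMeasure ν
  memLp : MemLp id 2 ν
  le : ∀ ν' : Measure (E d), IsProbabilityMeasure ν' → MemLp id 2 ν' →
    barycenterObjective w μ ν ≤ barycenterObjective w μ ν'

/-- The barycentric map `(x j) ↦ ∑ j, w j • x j`. -/
def baryMap {d : ℕ} {ι : Type*} [Fintype ι] (w : ι → ℝ) (x : ι → E d) : E d :=
  ∑ j, w j • x j

/-- The set of couplings of the measures `μ j`. -/
def multiCouplings {d : ℕ} {ι : Type*} (μ : ι → Measure (E d)) : Set (Measure (ι → E d)) :=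
  {γ | ∀ j, γ.map (fun x => x j) = μ j}

/-- The multi-marginal transport cost `J(γ, w) = ∫ ∑ j, w j ‖∑ i, w i x i - x j‖² dγ(x)`. -/
def multiMarginalCost {d : ℕ} {ι : Type*} [Fintype ι] (w : ι → ℝ) (γ : Measure (ι → E d)) :
    ℝ≥0∞ :=
  ∫⁻ x, ENNReal.ofReal (∑ j, w j * ‖baryMap w x - x j‖ ^ 2) ∂γ

/-- `ν` is a barycenter in the multi-marginal sense: the image under the barycentric map of a
coupling of the `μ j` of least multi-marginal cost. -/
def IsMultiMarginalBarycenter {d : ℕ} {ι : Type*} [Fintype ι] (w : ι → ℝ)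
    (μ : ι → Measure (E d)) (ν : Measure (E d)) : Prop :=
  ∃ γ ∈ multiCouplings μ, (∀ γ' ∈ multiCouplings μ, multiMarginalCost w γ ≤ multiMarginalCost w γ') ∧
    ν = γ.map (baryMap w)

/-! ### Path-independent flow matching with affine conditional paths -/

/-- The density at `x` of the Gaussian `N(m, σ² I)` on `ℝᵈ`. -/
def gaussDensity {d : ℕ} (σ : ℝ) (m x : E d) : ℝ :=
  (Real.sqrt (2 * Real.pi * σ ^ 2) ^ d)⁻¹ * Real.exp (-‖x - m‖ ^ 2 / (2 * σ ^ 2))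

/-- The conditional density `p_{t,s}(x | z) = N(x | a + t (b - a) + s (c - a), σ² I)` for the
latent variable `z = (a, b, c)`. -/
def condDensity {d : ℕ} (σ t s : ℝ) (z : E d × E d × E d) (x : E d) : ℝ :=
  gaussDensity σ (z.1 + t • (z.2.1 - z.1) + s • (z.2.2 - z.1)) x

/-- The marginal density `p_{t,s}(x) = ∫ p_{t,s}(x | z) dq(z)`. -/
def marginalDensity {d : ℕ} (q : Measure (E d × E d × E d)) (σ t s : ℝ) (x : E d) : ℝ :=
  ∫ z, condDensity σ t s z x ∂q

/-- The marginal distribution, with density `p_{t,s}`. -/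
def marginal {d : ℕ} (q : Measure (E d × E d × E d)) (σ t s : ℝ) : Measure (E d) :=
  volume.withDensity fun x => ENNReal.ofReal (marginalDensity q σ t s x)

/-- The unconditional vector field in the `t`-direction,
`u_{t,s}(x) = E_q [u_{t,s}(x | z) p_{t,s}(x | z) / p_{t,s}(x)]` with `u_{t,s}(x | z) = b - a`. -/
def fieldU {d : ℕ} (q : Measure (E d × E d × E d)) (σ t s : ℝ) (x : E d) : E d :=
  ∫ z, (condDensity σ t s z x / marginalDensity q σ t s x) • (z.2.1 - z.1) ∂q

/-- The unconditional vector field in the `s`-direction,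
`v_{t,s}(x) = E_q [v_{t,s}(x | z) p_{t,s}(x | z) / p_{t,s}(x)]` with `v_{t,s}(x | z) = c - a`. -/
def fieldV {d : ℕ} (q : Measure (E d × E d × E d)) (σ t s : ℝ) (x : E d) : E d :=
  ∫ z, (condDensity σ t s z x / marginalDensity q σ t s x) • (z.2.2 - z.1) ∂q

/-- `Φ` and `Ψ` are the flow maps of the vector fields `u` (in the `t`-direction) and `v` (in the
`s`-direction) on the parameter square: `∂ₜ Φ = u(Φ)`, `∂ₛ Ψ = v(Ψ)`, `Φ_{0,0} = Ψ_{0,0} = id`, with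
initial conditions `Φ_{0,s} = Ψ_{0,s}` and `Ψ_{t,0} = Φ_{t,0}` on the axes. So `Φ_{t,s}` follows `v`
from `(0,0)` to `(0,s)` and then `u` from `(0,s)` to `(t,s)`, and `Ψ_{t,s}` follows `u` first and `v`
second. The differential equations need only hold from almost every starting point for `μ`. -/
structure IsFlowPair {d : ℕ} (u v : ℝ → ℝ → E d → E d) (μ : Measure (E d))
    (Φ Ψ : ℝ → ℝ → E d → E d) : Prop where
  Φ_zero : ∀ x, Φ 0 0 x = x
  Ψ_zero : ∀ x, Ψ 0 0 x = x
  Φ_init : ∀ s ∈ Icc (0 : ℝ) 1, ∀ x, Φ 0 s x = Ψ 0 s x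
  Ψ_init : ∀ t ∈ Icc (0 : ℝ) 1, ∀ x, Ψ t 0 x = Φ t 0 x
  Φ_ode : ∀ s ∈ Icc (0 : ℝ) 1, ∀ᵐ x ∂μ, ∀ t ∈ Icc (0 : ℝ) 1,
    HasDerivWithinAt (fun τ => Φ τ s x) (u t s (Φ t s x)) (Icc 0 1) t
  Ψ_ode : ∀ t ∈ Icc (0 : ℝ) 1, ∀ᵐ x ∂μ, ∀ s ∈ Icc (0 : ℝ) 1,
    HasDerivWithinAt (fun τ => Ψ t τ x) (v t s (Ψ t s x)) (Icc 0 1) s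

/-- The joint law of `(a, T₁ a, T₂ a)` for `a` distributed according to `ρ₀`. -/
def mapCoupling {d : ℕ} (ρ₀ : Measure (E d)) (T₁ T₂ : E d → E d) : Measure (E d × E d × E d) :=
  ρ₀.map fun a => (a, T₁ a, T₂ a)

/-- The paths `z_{t,s}(a) = (1 - t - s) a + t T₁ a + s T₂ a`. -/
def zPath {d : ℕ} (T₁ T₂ : E d → E d) (t s : ℝ) (a : E d) : E d :=
  (1 - t - s) • a + t • T₁ a + s • T₂ a

end PiFM

end

/-! Barycenters. When the weights sum to one, the weighted spread of points `x j` about their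
barycenter is half of `∑ i, ∑ j, w i * w j * ‖x i - x j‖ ^ 2`. Hence twice the multi-marginal cost
of a plan is a weighted sum of the quadratic costs of its pair marginals
(`two_mul_multiMarginalCost`), and it is bounded below by the same sum of squared Wasserstein
distances. In an admissible family every `T i ∘ (T j)⁻¹` is optimal, so the law of `(a, T₁ a, T₂ a)`
couples all pairs optimally at once and attains this bound. Gluing optimal plans from the `ρ j` to a
competitor `ν` along `ν` turns the barycenter objective into a multi-marginal cost plus the mean
squared distance from `ν` to the barycenter of the glued points
(`exists_plan_of_barycenterObjective`). This makes the two minimization problems equivalent.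

Uniqueness. An optimal plan has monotone support, since exchanging the targets of two
anti-correlated points would lower its cost, and a monotone relation is single-valued
Lebesgue-almost everywhere. So an optimal plan out of an absolutely continuous measure is unique
once some optimal map exists, and admissibility supplies such maps out of each `ρ k`. All
coordinates of positive weight are then functions of one of them
(`map_baryMap_eq_of_absolutelyContinuous`).

Flows. In each parameter direction the conditional Gaussians translate with constant velocity, and
the marginal field is their mean velocity, so density and field solve the continuity equation
(`solvesContinuityEq_mixture`). The transport of the density along trajectories
(`SolvesContinuityEq.map_eq`) comes from the explicit Euler scheme. By the continuity equation one
step preserves mass up to a factor `1 - ε h`. Fatou's lemma passes this to the limit as an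
inequality on open sets, and equality of total masses does the rest. Only trajectories from almost
every starting point are needed. The limit `σ → 0` is dominated convergence, because the marginal is
the law of a random center plus `σ` times a standard Gaussian. -/

namespace PiFM

/-! ### Couplings and existence of optimal plans -/

section Coupling

variable {d : ℕ}

/-- `π` is a coupling of `μ` and `ν`. -/
structure IsCoupling (π : Measure (E d × E d)) (μ ν : Measure (E d)) : Prop where
  map_fst : π.map Prod.fst = μ
  map_snd : π.map Prod.snd = ν

/-- The quadratic cost of a transport plan. -/
noncomputable def planCost (π : Measure (E d × E d)) : ℝ≥0∞ := ∫⁻ p, edist p.1 p.2 ^ 2 ∂π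

theorem IsCoupling.isProbabilityMeasure {π : Measure (E d × E d)} {μ ν : Measure (E d)}
    [IsProbabilityMeasure μ] (h : IsCoupling π μ ν) : IsProbabilityMeasure π := by
  refine ⟨?_⟩
  have := congrArg (fun m => m univ) h.map_fst
  simpa [Measure.map_apply measurable_fst MeasurableSet.univ] using this

theorem W2sq_le_planCost {π : Measure (E d × E d)} {μ ν : Measure (E d)} (h : IsCoupling π μ ν) :
    W2sq μ ν ≤ planCost π :=
  iInf₂_le (f := fun π _ => ∫⁻ p : E d × E d, edist p.1 p.2 ^ 2 ∂π) π ⟨h.1, h.2⟩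

theorem isCoupling_prod (μ ν : Measure (E d)) [IsProbabilityMeasure μ] [IsProbabilityMeasure ν] :
    IsCoupling (μ.prod ν) μ ν := by
  constructor
  · exact measurePreserving_fst.map_eq
  · exact measurePreserving_snd.map_eq

theorem measurable_edist_sq : Measurable fun p : E d × E d => edist p.1 p.2 ^ 2 :=
  (measurable_fst.edist measurable_snd).pow_const 2

/-- The integral is the supremum over `n` of the integrals of the truncations `min c n`. These are
bounded and continuous, so each is weakly continuous in the measure. -/
theorem lowerSemicontinuous_lintegral_continuous {X : Type*} [TopologicalSpace X]
    [MeasurableSpace X] [OpensMeasurableSpace X] {c : X → NNReal} (hc : Continuous c) :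
    LowerSemicontinuous fun π : ProbabilityMeasure X => ∫⁻ x, (c x : ℝ≥0∞) ∂(π : Measure X) := by
  let f : ℕ → BoundedContinuousFunction X NNReal := fun n =>
    BoundedContinuousFunction.mkOfBound ⟨fun x => min (c x) n, by fun_prop⟩ n (by
      intro x y
      rw [NNReal.dist_eq, abs_sub_le_iff]
      have h1 : ((min (c x) n : NNReal) : ℝ) ≤ n := by exact_mod_cast min_le_right (c x) (n : NNReal)
      have h2 : ((min (c y) n : NNReal) : ℝ) ≤ n := by exact_mod_cast min_le_right (c y) (n : NNReal)
      have h3 : (0 : ℝ) ≤ ((min (c x) n : NNReal) : ℝ) := NNReal.coe_nonneg _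
      have h4 : (0 : ℝ) ≤ ((min (c y) n : NNReal) : ℝ) := NNReal.coe_nonneg _
      constructor <;> simp only [ContinuousMap.coe_mk] <;> linarith)
  have hf : ∀ n x, f n x = min (c x) n := fun n x => rfl
  have key : (fun π : ProbabilityMeasure X => ∫⁻ x, (c x : ℝ≥0∞) ∂(π : Measure X)) =
      fun π : ProbabilityMeasure X => ⨆ n, ∫⁻ x, (f n x : ℝ≥0∞) ∂(π : Measure X) := by
    funext π
    rw [← lintegral_iSup]
    · refine lintegral_congr fun x => ?_
      simp only [hf]
      apply le_antisymm
      · obtain ⟨n, hn⟩ := exists_nat_ge (c x)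
        refine le_trans ?_ (le_iSup _ n)
        rw [min_eq_left hn]
      · exact iSup_le fun n => by exact_mod_cast min_le_left _ _
    · intro n
      exact (f n).continuous.measurable.coe_nnreal_ennreal
    · intro m n hmn x
      simp only [hf]
      exact_mod_cast min_le_min le_rfl (by exact_mod_cast hmn)
  rw [key]
  refine lowerSemicontinuous_iSup fun n => Continuous.lowerSemicontinuous ?_
  rw [continuous_iff_continuousAt]
  intro π
  exact (ProbabilityMeasure.tendsto_iff_forall_lintegral_tendsto.1 tendsto_id) (f n)

/-- Optimal couplings exist. -/
theorem exists_optimal_coupling (μ ν : Measure (E d)) [IsProbabilityMeasure μ]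
    [IsProbabilityMeasure ν] : ∃ π, IsCoupling π μ ν ∧ planCost π = W2sq μ ν := by
  let S : Set (ProbabilityMeasure (E d × E d)) := {π | IsCoupling (π : Measure (E d × E d)) μ ν}
  let μ' : ProbabilityMeasure (E d) := ⟨μ, ‹_›⟩
  let ν' : ProbabilityMeasure (E d) := ⟨ν, ‹_›⟩
  have hclosed : IsClosed S := by
    have h1 : S = {π : ProbabilityMeasure (E d × E d) | π.map measurable_fst.aemeasurable = μ'} ∩
        {π : ProbabilityMeasure (E d × E d) | π.map measurable_snd.aemeasurable = ν'} := by
      ext π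
      exact ⟨fun h => ⟨Subtype.ext h.1, Subtype.ext h.2⟩,
        fun h => ⟨congrArg Subtype.val h.1, congrArg Subtype.val h.2⟩⟩
    rw [h1]
    exact (isClosed_eq (ProbabilityMeasure.continuous_map continuous_fst) continuous_const).inter
      (isClosed_eq (ProbabilityMeasure.continuous_map continuous_snd) continuous_const)
  -- Both marginals are fixed, and a single measure on `ℝᵈ` is tight. Prokhorov's theorem then makes
  -- the closed set of couplings compact, and the lower semicontinuous cost attains its minimum.
  have htight : IsTightMeasureSet {((π : ProbabilityMeasure (E d × E d)) : Measure (E d × E d)) |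
      π ∈ S} := by
    apply IsTightMeasureSet.prodMk
    · refine (isTightMeasureSet_singleton (μ := μ)).subset ?_
      rintro _ ⟨_, ⟨π, hπ, rfl⟩, rfl⟩
      exact hπ.1
    · refine (isTightMeasureSet_singleton (μ := ν)).subset ?_
      rintro _ ⟨_, ⟨π, hπ, rfl⟩, rfl⟩
      exact hπ.2
  have hcomp : IsCompact S := by
    have := isCompact_closure_of_isTightMeasureSet htight
    rwa [hclosed.closure_eq] at this
  have hne : S.Nonempty := ⟨⟨μ.prod ν, inferInstance⟩, isCoupling_prod μ ν⟩
  have hlsc := lowerSemicontinuous_lintegral_continuous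
    (c := fun p : E d × E d => nndist p.1 p.2 ^ 2) (by fun_prop)
  obtain ⟨π, hπ, hmin⟩ := (hlsc.lowerSemicontinuousOn S).exists_isMinOn hne hcomp
  have hcost : ∀ π : Measure (E d × E d),
      ∫⁻ p, ((nndist p.1 p.2 ^ 2 : NNReal) : ℝ≥0∞) ∂π = planCost π := by
    intro π
    simp only [planCost, edist_nndist, ENNReal.coe_pow]
  refine ⟨π, hπ, le_antisymm (le_iInf₂ fun π' hπ' => ?_) (W2sq_le_planCost hπ)⟩
  have hπ'' : IsCoupling π' μ ν := ⟨hπ'.1, hπ'.2⟩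
  have := hmin (a := ⟨π', hπ''.isProbabilityMeasure⟩) hπ''
  simp only [hcost] at this
  exact this

theorem lintegral_enorm_sq_lt_top {μ : Measure (E d)} (h : MemLp id 2 μ) :
    ∫⁻ x, ‖x‖ₑ ^ 2 ∂μ < ∞ := by
  have := lintegral_rpow_enorm_lt_top_of_eLpNorm_lt_top (p := 2) (f := id) (μ := μ) (by simp) (by simp) h.2
  simpa using this

theorem edist_sq_le (x y : E d) : edist x y ^ 2 ≤ 2 * ‖x‖ₑ ^ 2 + 2 * ‖y‖ₑ ^ 2 := by
  have h : ‖x - y‖ ^ 2 ≤ 2 * ‖x‖ ^ 2 + 2 * ‖y‖ ^ 2 := by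
    nlinarith [norm_sub_le x y, norm_nonneg (x - y), sq_nonneg (‖x‖ - ‖y‖), norm_nonneg x, norm_nonneg y]
  have := ENNReal.ofReal_le_ofReal h
  rw [ENNReal.ofReal_add (by positivity) (by positivity), ENNReal.ofReal_mul (by positivity),
    ENNReal.ofReal_mul (by positivity), ENNReal.ofReal_pow (norm_nonneg _),
    ENNReal.ofReal_pow (norm_nonneg _), ENNReal.ofReal_pow (norm_nonneg _)] at this
  simpa [edist_eq_enorm_sub, ofReal_norm] using this

theorem IsCoupling.planCost_lt_top {π : Measure (E d × E d)} {μ ν : Measure (E d)}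
    (h : IsCoupling π μ ν) (hμ : MemLp id 2 μ) (hν : MemLp id 2 ν) : planCost π < ∞ := by
  have h1 : ∫⁻ p, ‖p.1‖ₑ ^ 2 ∂π = ∫⁻ x, ‖x‖ₑ ^ 2 ∂μ := by
    rw [← h.map_fst, lintegral_map (by fun_prop) measurable_fst]
  have h2 : ∫⁻ p, ‖p.2‖ₑ ^ 2 ∂π = ∫⁻ x, ‖x‖ₑ ^ 2 ∂ν := by
    rw [← h.map_snd, lintegral_map (by fun_prop) measurable_snd]
  calc planCost π ≤ ∫⁻ p, (2 * ‖p.1‖ₑ ^ 2 + 2 * ‖p.2‖ₑ ^ 2) ∂π := lintegral_mono fun p => edist_sq_le _ _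
    _ = 2 * (∫⁻ x, ‖x‖ₑ ^ 2 ∂μ) + 2 * (∫⁻ x, ‖x‖ₑ ^ 2 ∂ν) := by
      rw [lintegral_add_left (by fun_prop), lintegral_const_mul _ (by fun_prop),
        lintegral_const_mul _ (by fun_prop), h1, h2]
    _ < ∞ := ENNReal.add_lt_top.2 ⟨ENNReal.mul_lt_top (by simp) (lintegral_enorm_sq_lt_top hμ),
      ENNReal.mul_lt_top (by simp) (lintegral_enorm_sq_lt_top hν)⟩

theorem W2sq_lt_top {μ ν : Measure (E d)} [IsProbabilityMeasure μ] [IsProbabilityMeasure ν]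
    (hμ : MemLp id 2 μ) (hν : MemLp id 2 ν) : W2sq μ ν < ∞ :=
  (W2sq_le_planCost (isCoupling_prod μ ν)).trans_lt ((isCoupling_prod μ ν).planCost_lt_top hμ hν)

end Coupling

/-! ### Monotonicity of optimal plans and uniqueness out of an absolutely continuous source -/

section Monotone

variable {d : ℕ}

/-- The correlation `⟪x - x', y - y'⟫` of two points `(x, y)`, `(x', y')` of a transport plan. -/
noncomputable def pairing (z : (E d × E d) × (E d × E d)) : ℝ :=
  inner ℝ (z.1.1 - z.2.1) (z.1.2 - z.2.2)

theorem continuous_pairing : Continuous (pairing (d := d)) := by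
  unfold pairing; fun_prop

theorem pairing_swap (z : (E d × E d) × (E d × E d)) : pairing z.swap = pairing z := by
  simp only [pairing, Prod.fst_swap, Prod.snd_swap]
  rw [← neg_sub z.1.1, ← neg_sub z.1.2, inner_neg_neg]

open Classical in
/-- Exchange the targets of two points of a transport plan that are anti-correlated. -/
noncomputable def swapTarget (z : (E d × E d) × (E d × E d)) : E d × E d :=
  if pairing z < 0 then (z.1.1, z.2.2) else z.1

theorem measurable_swapTarget : Measurable (swapTarget (d := d)) :=
  Measurable.ite (measurableSet_lt continuous_pairing.measurable measurable_const)
    (by fun_prop) (by fun_prop)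

theorem fst_swapTarget (z : (E d × E d) × (E d × E d)) : (swapTarget z).1 = z.1.1 := by
  unfold swapTarget; split_ifs <;> rfl

/-- Exchanging the two independent points preserves both `π.prod π` and the event of
anti-correlation. On that event it therefore makes no difference which of the two targets is read.
-/
theorem lintegral_snd_swapTarget (π : Measure (E d × E d)) [SFinite π] {f : E d → ℝ≥0∞}
    (hf : Measurable f) :
    ∫⁻ z, f (swapTarget z).2 ∂(π.prod π) = ∫⁻ z, f z.1.2 ∂(π.prod π) := by
  let B : Set ((E d × E d) × (E d × E d)) := {z | pairing z < 0}
  have hB : MeasurableSet B := measurableSet_lt continuous_pairing.measurable measurable_const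
  have h1 : ∀ z, f (swapTarget z).2 =
      B.indicator (fun z => f z.2.2) z + Bᶜ.indicator (fun z => f z.1.2) z := by
    intro z
    by_cases hz : pairing z < 0
    · have : z ∈ B := hz
      simp [swapTarget, hz, this]
    · have : z ∉ B := hz
      simp [swapTarget, hz, this]
  have h2 : ∀ z, f z.1.2 =
      B.indicator (fun z => f z.1.2) z + Bᶜ.indicator (fun z => f z.1.2) z := by
    intro z
    exact (congrFun (indicator_self_add_compl B (fun z => f z.1.2)) z).symm
  simp_rw [h1]
  conv_rhs => enter [2, z]; rw [h2]
  have m1 : Measurable (B.indicator fun z : (E d × E d) × (E d × E d) => f z.2.2) :=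
    (hf.comp (by fun_prop)).indicator hB
  have m2 : Measurable (B.indicator fun z : (E d × E d) × (E d × E d) => f z.1.2) :=
    (hf.comp (by fun_prop)).indicator hB
  rw [lintegral_add_left m1, lintegral_add_left m2]
  congr 1
  conv_lhs => rw [← Measure.prod_swap, lintegral_map m1 measurable_swap]
  refine lintegral_congr fun z => ?_
  have : z.swap ∈ B ↔ z ∈ B := by simp only [B]; change pairing z.swap < 0 ↔ _; rw [pairing_swap]; rfl
  by_cases hz : z ∈ B
  · rw [indicator_of_mem hz, indicator_of_mem (this.2 hz)]; rfl
  · rw [indicator_of_notMem hz, indicator_of_notMem (mt this.1 hz)]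

theorem isCoupling_map_swapTarget {π : Measure (E d × E d)} {μ ν : Measure (E d)}
    [IsProbabilityMeasure π] (h : IsCoupling π μ ν) :
    IsCoupling ((π.prod π).map swapTarget) μ ν := by
  have hfst : (π.prod π).map Prod.fst = π := measurePreserving_fst.map_eq
  constructor
  · rw [Measure.map_map measurable_fst measurable_swapTarget, ← h.map_fst]
    conv_rhs => rw [← hfst]
    rw [Measure.map_map measurable_fst measurable_fst]
    congr 1
    exact funext fst_swapTarget
  · rw [← h.map_snd]
    refine Measure.ext_of_lintegral _ fun f hf => ?_
    rw [lintegral_map hf measurable_snd, lintegral_map (f := fun p : E d × E d => f p.2) (hf.comp measurable_snd) measurable_swapTarget,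
      lintegral_map hf measurable_snd]
    refine (lintegral_snd_swapTarget π hf).trans ?_
    conv_rhs => rw [← hfst]
    rw [lintegral_map (f := fun p : E d × E d => f p.2) (hf.comp measurable_snd) measurable_fst]

theorem edist_sq_eq (x y : E d) : edist x y ^ 2 = ENNReal.ofReal (‖x - y‖ ^ 2) := by
  rw [ENNReal.ofReal_pow (norm_nonneg _), ofReal_norm, edist_eq_enorm_sub]

/-- Expanding the squares, crossing the targets changes the total cost of two points by twice their
pairing. The gain is added on the left to avoid subtraction in `ℝ≥0∞`; it vanishes where nothing is
exchanged. -/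
theorem cost_swapTarget (z : (E d × E d) × (E d × E d)) :
    edist (swapTarget z).1 (swapTarget z).2 ^ 2 +
      edist (swapTarget z.swap).1 (swapTarget z.swap).2 ^ 2 + ENNReal.ofReal (-(2 * pairing z)) =
    edist z.1.1 z.1.2 ^ 2 + edist z.2.1 z.2.2 ^ 2 := by
  by_cases hz : pairing z < 0
  · have hz' : pairing z.swap < 0 := by rwa [pairing_swap]
    simp only [swapTarget, hz, hz', if_true, edist_sq_eq, Prod.fst_swap, Prod.snd_swap]
    rw [← ENNReal.ofReal_add (by positivity) (by positivity),
      ← ENNReal.ofReal_add (by positivity) (by linarith),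
      ← ENNReal.ofReal_add (by positivity) (by positivity)]
    congr 1
    simp only [pairing, @norm_sub_sq ℝ, inner_sub_left, inner_sub_right, RCLike.re_to_real]
    ring
  · have hz' : ¬ pairing z.swap < 0 := by rwa [pairing_swap]
    simp only [swapTarget, hz, hz', if_false, Prod.fst_swap]
    rw [ENNReal.ofReal_of_nonpos (by linarith), add_zero]

/-- Two independent points of an optimal plan are almost surely nonnegatively correlated. -/
theorem ae_pairing_nonneg {π : Measure (E d × E d)} {μ ν : Measure (E d)}
    [IsProbabilityMeasure π] (h : IsCoupling π μ ν) (hopt : planCost π = W2sq μ ν)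
    (hfin : planCost π ≠ ∞) : ∀ᵐ z ∂(π.prod π), 0 ≤ pairing z := by
  have hfst : (π.prod π).map Prod.fst = π := measurePreserving_fst.map_eq
  have hsnd : (π.prod π).map Prod.snd = π := measurePreserving_snd.map_eq
  have mc := measurable_edist_sq (d := d)
  have e1 : ∫⁻ z, edist z.1.1 z.1.2 ^ 2 ∂(π.prod π) = planCost π := by
    conv_rhs => rw [← hfst, planCost, lintegral_map mc measurable_fst]
  have e2 : ∫⁻ z, edist z.2.1 z.2.2 ^ 2 ∂(π.prod π) = planCost π := by
    conv_rhs => rw [← hsnd, planCost, lintegral_map mc measurable_snd]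
  have m1 : Measurable fun z : (E d × E d) × (E d × E d) =>
      edist (swapTarget z).1 (swapTarget z).2 ^ 2 := mc.comp measurable_swapTarget
  have m4 : Measurable fun z : (E d × E d) × (E d × E d) => edist z.2.1 z.2.2 ^ 2 :=
    mc.comp measurable_snd
  have e3 : ∫⁻ z, edist (swapTarget z).1 (swapTarget z).2 ^ 2 ∂(π.prod π) =
      planCost ((π.prod π).map swapTarget) := by
    rw [planCost, lintegral_map mc measurable_swapTarget]
  have e4 : ∫⁻ z, edist (swapTarget z.swap).1 (swapTarget z.swap).2 ^ 2 ∂(π.prod π) =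
      planCost ((π.prod π).map swapTarget) := by
    rw [← e3]
    conv_rhs => rw [← Measure.prod_swap, lintegral_map m1 measurable_swap]
  have hle := W2sq_le_planCost (isCoupling_map_swapTarget h)
  rw [← hopt] at hle
  have hsum := lintegral_congr (μ := π.prod π) cost_swapTarget
  have m2 : Measurable fun z : (E d × E d) × (E d × E d) =>
      edist (swapTarget z.swap).1 (swapTarget z.swap).2 ^ 2 := m1.comp measurable_swap
  have m3 : Measurable fun z : (E d × E d) × (E d × E d) => ENNReal.ofReal (-(2 * pairing z)) :=
    ((continuous_pairing.measurable.const_mul 2).neg).ennreal_ofReal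
  rw [lintegral_add_right _ m3, lintegral_add_right _ m2, e3, e4,
    lintegral_add_right _ m4, e1, e2] at hsum
  have h0 : ∫⁻ z, ENNReal.ofReal (-(2 * pairing z)) ∂(π.prod π) = 0 := by
    -- The swapped plan is again a coupling, so it costs at least as much as the optimal one.
    -- Finiteness of the cost then lets the gain be isolated by cancellation.
    have h5 : planCost π + planCost π + ∫⁻ z, ENNReal.ofReal (-(2 * pairing z)) ∂(π.prod π) ≤
        planCost π + planCost π + 0 := by
      rw [add_zero]
      calc _ ≤ planCost ((π.prod π).map swapTarget) + planCost ((π.prod π).map swapTarget) +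
            ∫⁻ z, ENNReal.ofReal (-(2 * pairing z)) ∂(π.prod π) := by gcongr
        _ = _ := hsum
    exact le_antisymm ((ENNReal.add_le_add_iff_left (ENNReal.add_ne_top.2 ⟨hfin, hfin⟩)).1 h5) bot_le
  rw [lintegral_eq_zero_iff m3] at h0
  filter_upwards [h0] with z hz
  have := ENNReal.ofReal_eq_zero.1 hz
  linarith

/-- Anti-correlation is an open condition. If it held at two support points it would hold on a
product of neighborhoods, which has positive mass for `π.prod π`. -/
theorem support_pairing_nonneg {π : Measure (E d × E d)} {μ ν : Measure (E d)}
    [IsProbabilityMeasure π] (h : IsCoupling π μ ν) (hopt : planCost π = W2sq μ ν)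
    (hfin : planCost π ≠ ∞) {p q : E d × E d} (hp : p ∈ π.support) (hq : q ∈ π.support) :
    0 ≤ pairing (p, q) := by
  by_contra! hlt
  have hopen : IsOpen {z : (E d × E d) × (E d × E d) | pairing z < 0} :=
    isOpen_lt continuous_pairing continuous_const
  obtain ⟨U, V, hU, hV, hpU, hqV, hUV⟩ := isOpen_prod_iff.1 hopen p q hlt
  have h1 := (Measure.mem_support_iff_forall p).1 hp U (hU.mem_nhds hpU)
  have h2 := (Measure.mem_support_iff_forall q).1 hq V (hV.mem_nhds hqV)
  have h3 : (π.prod π) (U ×ˢ V) = 0 := by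
    refine measure_mono_null hUV ?_
    have := ae_pairing_nonneg h hopt hfin
    rw [ae_iff] at this
    simpa using this
  rw [Measure.prod_prod] at h3
  exact (ENNReal.mul_pos h1.ne' h2.ne').ne' h3

/-- A monotone relation is single-valued at almost every point. -/
theorem ae_subsingleton_of_monotone {Γ : Set (E d × E d)} (hΓ : IsClosed Γ)
    (hmono : ∀ p ∈ Γ, ∀ q ∈ Γ, 0 ≤ pairing (p, q)) :
    ∀ᵐ x : E d, ∀ y y', (x, y) ∈ Γ → (x, y') ∈ Γ → y = y' := by
  -- The points with two images differ in some coordinate, so these sets cover them up to exchanging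
  -- the images. The bound `n` on the images makes each set closed, as a projection along a compact
  -- factor; the gap `1 / (n + 1)` keeps the condition closed.
  let K : Fin d → ℕ → Set (E d) := fun i n => {x | ∃ y y', (x, y) ∈ Γ ∧ (x, y') ∈ Γ ∧
    y ∈ Metric.closedBall 0 n ∧ y' ∈ Metric.closedBall 0 n ∧ y i + 1 / (n + 1) ≤ y' i}
  have hK : ∀ i n, IsClosed (K i n) := by
    intro i n
    let C : Set (E d × (E d × E d)) := {z | (z.1, z.2.1) ∈ Γ ∧ (z.1, z.2.2) ∈ Γ ∧
      z.2.1 i + 1 / (n + 1 : ℝ) ≤ z.2.2 i}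
    have hC : IsClosed C := by
      have c1 : Continuous fun z : E d × (E d × E d) => z.2.1 i + 1 / (n + 1 : ℝ) := by fun_prop
      have c2 : Continuous fun z : E d × (E d × E d) => z.2.2 i := by fun_prop
      exact (hΓ.preimage (by fun_prop)).inter ((hΓ.preimage (by fun_prop)).inter
        (isClosed_le c1 c2))
    let B : Set (E d × E d) := Metric.closedBall 0 n ×ˢ Metric.closedBall 0 n
    have hB : IsCompact B := (isCompact_closedBall _ _).prod (isCompact_closedBall _ _)
    have : K i n = Prod.fst '' (C ∩ univ ×ˢ B) := by
      ext x
      constructor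
      · rintro ⟨y, y', h1, h2, h3, h4, h5⟩
        exact ⟨(x, y, y'), ⟨⟨h1, h2, h5⟩, mem_univ _, h3, h4⟩, rfl⟩
      · rintro ⟨⟨x, y, y'⟩, ⟨⟨h1, h2, h5⟩, -, h3, h4⟩, rfl⟩
        exact ⟨y, y', h1, h2, h3, h4, h5⟩
    rw [this]
    have hproj : IsClosedMap (Prod.fst : E d × B → E d) := by
      have : CompactSpace B := isCompact_iff_compactSpace.1 hB
      exact isClosedMap_fst_of_compactSpace
    have h2 : Prod.fst '' (C ∩ univ ×ˢ B) =
        (Prod.fst : E d × B → E d) '' ((fun z : E d × B => (z.1, (z.2 : E d × E d))) ⁻¹' C) := by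
      ext x
      constructor
      · rintro ⟨⟨x, w⟩, ⟨h1, -, h3⟩, rfl⟩
        exact ⟨(x, ⟨w, h3⟩), h1, rfl⟩
      · rintro ⟨⟨x, w⟩, h1, rfl⟩
        exact ⟨(x, (w : E d × E d)), ⟨h1, mem_univ _, w.2⟩, rfl⟩
    rw [h2]
    exact hproj _ (hC.preimage (by fun_prop))
  have hnull : ∀ i n, ∀ᵐ x : E d, x ∉ K i n := by
    intro i n
    let v : E d := EuclideanSpace.single i (1 : ℝ)
    let Lm : ℝ →ₗ[ℝ] E d := LinearMap.toSpanSingleton ℝ (E d) v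
    -- By Fubini it suffices that every line in the `i`-th coordinate direction meets the set in a
    -- null set; it meets it in a countable one.
    refine ae_mem_of_ae_add_linearMap_mem Lm volume volume (s := (K i n)ᶜ)
      (hK i n).measurableSet.compl fun x => ?_
    -- on a line, the gaps of a monotone relation are disjoint intervals
    let S : Set ℝ := {τ | x + Lm τ ∈ K i n}
    have hS : S.Countable := by
      choose! f g hf using fun τ (hτ : τ ∈ S) => hτ
      have hlt : ∀ τ ∈ S, f τ i < g τ i := fun τ hτ =>
        lt_of_lt_of_le (lt_add_of_pos_right _ (by positivity)) (hf τ hτ).2.2.2.2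
      have hsep : ∀ τ ∈ S, ∀ τ' ∈ S, τ < τ' → g τ i ≤ f τ' i := by
        intro τ hτ τ' hτ' hlt
        have h1 := hmono _ (hf τ' hτ').1 _ (hf τ hτ).2.1
        have h2 : x + Lm τ' - (x + Lm τ) = (τ' - τ) • v := by
          simp only [Lm, LinearMap.toSpanSingleton_apply, sub_smul]; abel
        simp only [pairing] at h1
        rw [h2, inner_smul_left] at h1
        have h3 : inner ℝ v (f τ' - g τ) = f τ' i - g τ i := by
          simp [v, EuclideanSpace.inner_single_left]
        rw [h3] at h1
        simp only [conj_trivial] at h1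
        have := nonneg_of_mul_nonneg_right h1 (sub_pos.2 hlt)
        linarith
      refine Set.PairwiseDisjoint.countable_of_isOpen (s := fun τ => Ioo (f τ i) (g τ i)) ?_
        (fun τ _ => isOpen_Ioo) (fun τ hτ => nonempty_Ioo.2 (hlt τ hτ))
      intro τ hτ τ' hτ' hne
      rcases lt_or_gt_of_ne hne with h | h
      · refine Set.disjoint_left.2 fun r hr hr' => ?_
        exact absurd (hr.2.trans_le (hsep τ hτ τ' hτ' h)) (not_lt.2 hr'.1.le)
      · refine Set.disjoint_left.2 fun r hr hr' => ?_
        exact absurd (hr'.2.trans_le (hsep τ' hτ' τ hτ h)) (not_lt.2 hr.1.le)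
    exact hS.ae_notMem volume
  filter_upwards [ae_all_iff.2 fun i => ae_all_iff.2 (hnull i)] with x hx
  have key : ∀ y y' : E d, (x, y) ∈ Γ → (x, y') ∈ Γ → ∀ i, ¬ y i < y' i := by
    intro y y' hy hy' i hlt
    obtain ⟨n1, h1⟩ := exists_nat_ge ‖y‖
    obtain ⟨n2, h2⟩ := exists_nat_ge ‖y'‖
    obtain ⟨n3, h3⟩ := exists_nat_one_div_lt (sub_pos.2 hlt)
    let n := max n1 (max n2 n3)
    refine hx i n ⟨y, y', hy, hy', ?_, ?_, ?_⟩
    · rw [mem_closedBall_zero_iff]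
      exact h1.trans (by exact_mod_cast le_max_left _ _)
    · rw [mem_closedBall_zero_iff]
      exact h2.trans (by exact_mod_cast (le_max_left n2 n3).trans (le_max_right _ _))
    · have h4 : (n3 : ℝ) ≤ n := by exact_mod_cast (le_max_right n2 n3).trans (le_max_right _ _)
      have : 1 / ((n : ℝ) + 1) ≤ 1 / ((n3 : ℝ) + 1) := by gcongr
      linarith
  intro y y' hy hy'
  ext i
  exact le_antisymm (not_lt.1 (key y' y hy' hy i)) (not_lt.1 (key y y' hy hy' i))

theorem IsCoupling.half_add {π₁ π₂ : Measure (E d × E d)} {μ ν : Measure (E d)}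
    (h₁ : IsCoupling π₁ μ ν) (h₂ : IsCoupling π₂ μ ν) :
    IsCoupling ((2⁻¹ : ℝ≥0∞) • (π₁ + π₂)) μ ν := by
  have half : ∀ m : Measure (E d), (2⁻¹ : ℝ≥0∞) • (m + m) = m := fun m => by
    rw [← two_smul ℝ≥0∞ m, smul_smul, ENNReal.inv_mul_cancel (by simp) (by simp), one_smul]
  constructor
  · rw [Measure.map_smul, Measure.map_add _ _ measurable_fst, h₁.1, h₂.1, half]
  · rw [Measure.map_smul, Measure.map_add _ _ measurable_snd, h₁.2, h₂.2, half]

/-- If the source is absolutely continuous, an optimal plan induced by a map is the only one. -/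
theorem optimal_coupling_eq {π : Measure (E d × E d)} {μ ν : Measure (E d)}
    [IsProbabilityMeasure μ] (hac : μ ≪ volume) (hW : W2sq μ ν ≠ ∞)
    (h : IsCoupling π μ ν) (hopt : planCost π = W2sq μ ν) {S : E d → E d}
    (hS : IsOptimalTransportMap S μ ν) : π = μ.map fun x => (x, S x) := by
  have hSm : AEMeasurable (fun x => (x, S x)) μ := aemeasurable_id.prodMk hS.aemeasurable
  set π₀ : Measure (E d × E d) := μ.map fun x => (x, S x) with hπ₀
  have h₀ : IsCoupling π₀ μ ν := by
    constructor
    · rw [hπ₀, AEMeasurable.map_map_of_aemeasurable measurable_fst.aemeasurable hSm]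
      exact Measure.map_id
    · rw [hπ₀, AEMeasurable.map_map_of_aemeasurable measurable_snd.aemeasurable hSm]
      exact hS.map_eq
  have hopt₀ : planCost π₀ = W2sq μ ν := by
    rw [planCost, hπ₀, lintegral_map' measurable_edist_sq.aemeasurable hSm]
    exact hS.cost_eq
  -- The midpoint of two optimal plans is optimal, and its support carries both of them. Being
  -- single-valued over almost every `x` and containing the graph of `S`, this support forces `π`
  -- onto that graph.
  set π' := (2⁻¹ : ℝ≥0∞) • (π + π₀) with hπ'
  have h' : IsCoupling π' μ ν := h.half_add h₀
  have := h'.isProbabilityMeasure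
  have hopt' : planCost π' = W2sq μ ν := by
    rw [planCost, hπ', lintegral_smul_measure, lintegral_add_measure]
    change 2⁻¹ * (planCost π + planCost π₀) = _
    rw [hopt, hopt₀, ← two_mul, ← mul_assoc, ENNReal.inv_mul_cancel (by simp) (by simp), one_mul]
  have hΓ := ae_subsingleton_of_monotone (Measure.isClosed_support (μ := π'))
    fun p hp q hq => support_pairing_nonneg h' hopt' (by rwa [hopt']) hp hq
  have hsupp : ∀ᵐ p ∂π', p ∈ π'.support := Measure.support_mem_ae
  have hab : π + π₀ ≪ π' :=
    (Measure.absolutelyContinuous_smul (by simp : (2⁻¹ : ℝ≥0∞) ≠ 0))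
  have hsuppadd := hab.ae_le hsupp
  have hsuppπ : ∀ᵐ p ∂π, p ∈ π'.support := (ae_mono (Measure.le_add_right le_rfl)) hsuppadd
  have hsupp₀ : ∀ᵐ p ∂π₀, p ∈ π'.support := (ae_mono (Measure.le_add_left le_rfl)) hsuppadd
  have hgr : ∀ᵐ x ∂μ, (x, S x) ∈ π'.support := ae_of_ae_map hSm hsupp₀
  have hx : ∀ᵐ x ∂μ, ∀ y, (x, y) ∈ π'.support → y = S x := by
    filter_upwards [hgr, hac.ae_le hΓ] with x h1 h2 y hy using h2 _ _ hy h1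
  have hx' : ∀ᵐ p ∂π, ∀ y, (p.1, y) ∈ π'.support → y = S p.1 := by
    rw [← h.map_fst] at hx
    exact ae_of_ae_map measurable_fst.aemeasurable hx
  have hp : ∀ᵐ p ∂π, p = (p.1, S p.1) := by
    filter_upwards [hx', hsuppπ] with p h1 h2
    exact Prod.ext rfl (h1 _ h2)
  have hSm' : AEMeasurable (fun x => (x, S x)) (π.map Prod.fst) := by rwa [h.map_fst]
  calc π = π.map id := Measure.map_id.symm
    _ = π.map ((fun x => (x, S x)) ∘ Prod.fst) := Measure.map_congr hp
    _ = (π.map Prod.fst).map fun x => (x, S x) :=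
      (AEMeasurable.map_map_of_aemeasurable hSm' measurable_fst.aemeasurable).symm
    _ = π₀ := by rw [h.map_fst]

end Monotone

/-! ### Wasserstein barycenters and multi-marginal transport -/

section Barycenter

variable {d : ℕ} {ι : Type*}

/-- The `(i, j)` marginal of a multi-marginal plan. -/
noncomputable def pairMarginal (γ : Measure (ι → E d)) (i j : ι) : Measure (E d × E d) :=
  γ.map fun x => (x i, x j)

theorem isCoupling_pairMarginal {ρ : ι → Measure (E d)} {γ : Measure (ι → E d)}
    (hγ : γ ∈ multiCouplings ρ) (i j : ι) : IsCoupling (pairMarginal γ i j) (ρ i) (ρ j) := by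
  constructor
  · rw [pairMarginal, Measure.map_map measurable_fst (by fun_prop)]
    exact hγ i
  · rw [pairMarginal, Measure.map_map measurable_snd (by fun_prop)]
    exact hγ j

theorem planCost_pairMarginal (γ : Measure (ι → E d)) (i j : ι) :
    planCost (pairMarginal γ i j) = ∫⁻ x, edist (x i) (x j) ^ 2 ∂γ := by
  rw [planCost, pairMarginal, lintegral_map measurable_edist_sq (by fun_prop)]

theorem measurable_edist_apply_sq (i j : ι) :
    Measurable fun x : ι → E d => edist (x i) (x j) ^ 2 :=
  measurable_edist_sq.comp (f := fun x : ι → E d => (x i, x j)) (by fun_prop)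

variable [Fintype ι]

theorem measurable_baryMap (w : ι → ℝ) : Measurable (baryMap (d := d) w) := by
  unfold baryMap; fun_prop

/-- Huygens' identity: the cross terms cancel because the weighted deviations from the barycenter
sum to zero. -/
theorem sum_weight_norm_sub_sq {w : ι → ℝ} (hw : ∑ j, w j = 1) (x : ι → E d) (y : E d) :
    ∑ j, w j * ‖y - x j‖ ^ 2 = (∑ j, w j * ‖baryMap w x - x j‖ ^ 2) + ‖y - baryMap w x‖ ^ 2 := by
  have h0 : ∑ j, w j • (baryMap w x - x j) = 0 := by
    simp only [smul_sub, Finset.sum_sub_distrib, ← Finset.sum_smul, hw, one_smul]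
    simp [baryMap]
  have h1 : ∑ j, w j * inner ℝ (y - baryMap w x) (baryMap w x - x j) = 0 := by
    simp_rw [← inner_smul_right]
    rw [← inner_sum, h0, inner_zero_right]
  have h2 : ∀ j, w j * ‖y - x j‖ ^ 2 = w j * ‖y - baryMap w x‖ ^ 2 +
      2 * (w j * inner ℝ (y - baryMap w x) (baryMap w x - x j)) +
      w j * ‖baryMap w x - x j‖ ^ 2 := by
    intro j
    rw [show y - x j = (y - baryMap w x) + (baryMap w x - x j) by abel, norm_add_sq_real]
    ring
  simp_rw [h2]
  rw [Finset.sum_add_distrib, Finset.sum_add_distrib, ← Finset.mul_sum, h1, ← Finset.sum_mul, hw]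
  ring

/-- Huygens' identity at `y = x i`, averaged over `i` with the weights `w i`, produces the spread
twice. -/
theorem two_mul_sum_weight_norm_sub_sq {w : ι → ℝ} (hw : ∑ j, w j = 1) (x : ι → E d) :
    2 * ∑ j, w j * ‖baryMap w x - x j‖ ^ 2 = ∑ i, ∑ j, w i * w j * ‖x i - x j‖ ^ 2 := by
  have h : ∀ i, ∑ j, w i * w j * ‖x i - x j‖ ^ 2 =
      w i * (∑ j, w j * ‖baryMap w x - x j‖ ^ 2) + w i * ‖baryMap w x - x i‖ ^ 2 := by
    intro i
    rw [norm_sub_rev (baryMap w x) (x i), ← mul_add, ← sum_weight_norm_sub_sq hw x (x i),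
      Finset.mul_sum]
    exact Finset.sum_congr rfl fun j _ => by ring
  simp_rw [h]
  rw [Finset.sum_add_distrib, ← Finset.sum_mul, hw]
  ring

theorem sum_ofReal_mul_edist_sq {w : ι → ℝ} (hw0 : ∀ j, 0 ≤ w j) (x : ι → E d) (y : E d) :
    ∑ j, ENNReal.ofReal (w j) * edist (x j) y ^ 2 =
      ENNReal.ofReal (∑ j, w j * ‖y - x j‖ ^ 2) := by
  rw [ENNReal.ofReal_sum_of_nonneg fun j _ => mul_nonneg (hw0 j) (by positivity)]
  refine Finset.sum_congr rfl fun j _ => ?_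
  rw [edist_comm, edist_sq_eq, ENNReal.ofReal_mul (hw0 j)]

theorem two_mul_multiMarginalCost {w : ι → ℝ} (hw0 : ∀ j, 0 ≤ w j) (hw : ∑ j, w j = 1)
    (γ : Measure (ι → E d)) : 2 * multiMarginalCost w γ =
      ∑ i, ∑ j, ENNReal.ofReal (w i * w j) * planCost (pairMarginal γ i j) := by
  have h : ∀ x : ι → E d, 2 * ENNReal.ofReal (∑ j, w j * ‖baryMap w x - x j‖ ^ 2) =
      ∑ i, ∑ j, ENNReal.ofReal (w i * w j) * edist (x i) (x j) ^ 2 := by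
    intro x
    have h2 : (2 : ℝ≥0∞) = ENNReal.ofReal 2 := by simp
    conv_lhs => enter [1]; rw [h2]
    rw [← ENNReal.ofReal_mul (by norm_num), two_mul_sum_weight_norm_sub_sq hw,
      ENNReal.ofReal_sum_of_nonneg fun i _ => Finset.sum_nonneg fun j _ =>
        mul_nonneg (mul_nonneg (hw0 i) (hw0 j)) (by positivity)]
    refine Finset.sum_congr rfl fun i _ => ?_
    rw [ENNReal.ofReal_sum_of_nonneg fun j _ =>
        mul_nonneg (mul_nonneg (hw0 i) (hw0 j)) (by positivity)]
    refine Finset.sum_congr rfl fun j _ => ?_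
    rw [ENNReal.ofReal_mul (mul_nonneg (hw0 i) (hw0 j)), edist_sq_eq]
  have hm := measurable_edist_apply_sq (d := d) (ι := ι)
  rw [multiMarginalCost, ← lintegral_const_mul' _ _ (by simp)]
  simp_rw [h]
  rw [lintegral_finsetSum _ fun i _ => Finset.measurable_sum _ fun j _ => (hm i j).const_mul _]
  refine Finset.sum_congr rfl fun i _ => ?_
  rw [lintegral_finsetSum _ fun j _ => (hm i j).const_mul _]
  refine Finset.sum_congr rfl fun j _ => ?_
  rw [lintegral_const_mul _ (hm i j), planCost_pairMarginal]

/-- Twice the least multi-marginal cost when all pairs can be coupled optimally at once. -/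
noncomputable def pairwiseCost (w : ι → ℝ) (ρ : ι → Measure (E d)) : ℝ≥0∞ :=
  ∑ i, ∑ j, ENNReal.ofReal (w i * w j) * W2sq (ρ i) (ρ j)

theorem pairwiseCost_le {w : ι → ℝ} (hw0 : ∀ j, 0 ≤ w j) (hw : ∑ j, w j = 1)
    {ρ : ι → Measure (E d)} {γ : Measure (ι → E d)} (hγ : γ ∈ multiCouplings ρ) :
    pairwiseCost w ρ ≤ 2 * multiMarginalCost w γ := by
  rw [two_mul_multiMarginalCost hw0 hw]
  refine Finset.sum_le_sum fun i _ => Finset.sum_le_sum fun j _ => ?_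
  gcongr
  exact W2sq_le_planCost (isCoupling_pairMarginal hγ i j)

/-- Each term of the pairwise sum is at least its Wasserstein counterpart. Equality of the finite
sums forces equality term by term, and a positive coefficient can be cancelled. -/
theorem planCost_pairMarginal_eq {w : ι → ℝ} (hw0 : ∀ j, 0 ≤ w j) (hw : ∑ j, w j = 1)
    {ρ : ι → Measure (E d)} [∀ i, IsProbabilityMeasure (ρ i)] (hρ : ∀ i, MemLp id 2 (ρ i))
    {γ : Measure (ι → E d)} (hγ : γ ∈ multiCouplings ρ)
    (hcost : 2 * multiMarginalCost w γ ≤ pairwiseCost w ρ) {i j : ι} (hi : 0 < w i)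
    (hj : 0 < w j) : planCost (pairMarginal γ i j) = W2sq (ρ i) (ρ j) := by
  classical
  have hc := fun i j => isCoupling_pairMarginal hγ i j
  rw [two_mul_multiMarginalCost hw0 hw] at hcost
  simp only [pairwiseCost, ← Finset.sum_product'] at hcost
  have hle : ∀ p ∈ (Finset.univ : Finset ι) ×ˢ (Finset.univ : Finset ι),
      ENNReal.ofReal (w p.1 * w p.2) * W2sq (ρ p.1) (ρ p.2) ≤
      ENNReal.ofReal (w p.1 * w p.2) * planCost (pairMarginal γ p.1 p.2) := fun p _ => by
    gcongr
    exact W2sq_le_planCost (hc p.1 p.2)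
  have hfin : ∀ p ∈ (Finset.univ : Finset ι) ×ˢ (Finset.univ : Finset ι),
      ENNReal.ofReal (w p.1 * w p.2) * planCost (pairMarginal γ p.1 p.2) ≠ ∞ := fun p _ =>
    ENNReal.mul_ne_top ENNReal.ofReal_ne_top ((hc p.1 p.2).planCost_lt_top (hρ _) (hρ _)).ne
  have heq : ENNReal.ofReal (w i * w j) * W2sq (ρ i) (ρ j) =
      ENNReal.ofReal (w i * w j) * planCost (pairMarginal γ i j) := by
    refine le_antisymm (hle (i, j) (by simp)) ?_
    have hmem : (i, j) ∈ (Finset.univ : Finset ι) ×ˢ (Finset.univ : Finset ι) := by simp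
    rw [← Finset.add_sum_erase _ _ hmem, ← Finset.add_sum_erase _ _ hmem] at hcost
    refine (ENNReal.add_le_add_iff_right (ENNReal.sum_ne_top.2 fun p hp =>
      hfin p (Finset.mem_of_mem_erase hp))).1 (hcost.trans ?_)
    gcongr with p hp
    exact W2sq_le_planCost (hc p.1 p.2)
  have hpos := mul_pos hi hj
  exact ((ENNReal.mul_right_inj (by simpa using hpos) ENNReal.ofReal_ne_top).1 heq).symm

/-- The image of a multi-marginal plan under the barycentric map is at most as far from the
marginals as the multi-marginal cost tells. -/
theorem barycenterObjective_map_le {w : ι → ℝ} (hw0 : ∀ j, 0 ≤ w j) {ρ : ι → Measure (E d)}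
    {γ : Measure (ι → E d)} (hγ : γ ∈ multiCouplings ρ) :
    barycenterObjective w ρ (γ.map (baryMap w)) ≤ multiMarginalCost w γ := by
  have hb := measurable_baryMap (d := d) w
  have hm : ∀ j, Measurable fun x : ι → E d => edist (x j) (baryMap w x) ^ 2 := fun j =>
    ((measurable_pi_apply j).edist hb).pow_const 2
  rw [multiMarginalCost]
  simp_rw [← sum_ofReal_mul_edist_sq hw0]
  rw [lintegral_finsetSum _ fun j _ => (hm j).const_mul _]
  refine Finset.sum_le_sum fun j _ => ?_
  rw [lintegral_const_mul _ (hm j)]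
  gcongr
  have hc : IsCoupling (γ.map fun x => (x j, baryMap w x)) (ρ j) (γ.map (baryMap w)) := by
    constructor
    · rw [Measure.map_map measurable_fst (by fun_prop)]
      exact hγ j
    · rw [Measure.map_map measurable_snd (by fun_prop)]
      rfl
  refine (W2sq_le_planCost hc).trans_eq ?_
  rw [planCost, lintegral_map measurable_edist_sq (by fun_prop)]

/-- **Gluing lemma**: plans with a common second marginal are marginals of one measure. -/
theorem exists_gluing {ρ : ι → Measure (E d)} {ν : Measure (E d)} [IsProbabilityMeasure ν]
    [∀ i, IsProbabilityMeasure (ρ i)] {π : ι → Measure (E d × E d)}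
    (hπ : ∀ i, IsCoupling (π i) (ρ i) ν) :
    ∃ θ : Measure ((ι → E d) × E d), ∀ i, θ.map (fun z => (z.1 i, z.2)) = π i := by
  have := fun i => (hπ i).isProbabilityMeasure
  let κ : ι → ProbabilityTheory.Kernel (E d) (E d) := fun i =>
    ProbabilityTheory.condDistrib Prod.fst Prod.snd (π i)
  have hκ : ∀ i, ν.compProd (κ i) = (π i).map fun p => (p.2, p.1) := by
    intro i
    rw [← (hπ i).map_snd]
    exact ProbabilityTheory.compProd_map_condDistrib measurable_fst.aemeasurable
  -- Given the common point `y`, the other coordinates are drawn independently from the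
  -- disintegrations of the plans.
  let K : ProbabilityTheory.Kernel (E d) (ι → E d) :=
    { toFun := fun y => Measure.pi fun i => κ i y
      measurable' := by
        refine Measurable.measure_of_isPiSystem_of_isProbabilityMeasure generateFrom_pi.symm
          isPiSystem_pi ?_
        rintro _ ⟨s, hs, rfl⟩
        simp only [Measure.pi_pi]
        exact Finset.measurable_prod _ fun i _ =>
          (κ i).measurable_coe (hs i (mem_univ i)) }
  have hK : ∀ y, K y = Measure.pi fun i => κ i y := fun y => rfl
  have : ProbabilityTheory.IsMarkovKernel K := ⟨fun y => by rw [hK]; infer_instance⟩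
  have hKi : ∀ i, K.map (fun x => x i) = κ i := by
    intro i
    ext1 y
    rw [ProbabilityTheory.Kernel.map_apply _ (by fun_prop), hK]
    exact (measurePreserving_eval (fun i => κ i y) i).map_eq
  refine ⟨(ν.compProd K).map Prod.swap, fun i => ?_⟩
  rw [Measure.map_map (by fun_prop) measurable_swap]
  have h1 := hκ i
  rw [← hKi i, Measure.compProd_map (by fun_prop)] at h1
  have h2 := congrArg (Measure.map Prod.swap) h1
  rw [Measure.map_map measurable_swap (by fun_prop), Measure.map_map measurable_swap
    (by fun_prop)] at h2
  calc _ = (ν.compProd K).map (Prod.swap ∘ Prod.map id fun x => x i) := rfl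
    _ = (π i).map id := h2
    _ = π i := Measure.map_id

/-- Every `ν` comes from a multi-marginal plan, with the multi-marginal cost plus the defect of
`ν` being the image under the barycentric map as its objective. -/
theorem exists_plan_of_barycenterObjective {w : ι → ℝ} (hw0 : ∀ j, 0 ≤ w j) (hw : ∑ j, w j = 1)
    {ρ : ι → Measure (E d)} {ν : Measure (E d)} [IsProbabilityMeasure ν]
    [∀ i, IsProbabilityMeasure (ρ i)] :
    ∃ θ : Measure ((ι → E d) × E d), θ.map Prod.fst ∈ multiCouplings ρ ∧
      (Nonempty ι → θ.map Prod.snd = ν) ∧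
      barycenterObjective w ρ ν = multiMarginalCost w (θ.map Prod.fst) +
        ∫⁻ z, edist z.2 (baryMap w z.1) ^ 2 ∂θ := by
  choose π hπ hopt using fun i => exists_optimal_coupling (ρ i) ν
  obtain ⟨θ, hθ⟩ := exists_gluing hπ
  have hb := measurable_baryMap (d := d) w
  refine ⟨θ, fun i => ?_, fun ⟨i⟩ => ?_, ?_⟩
  · rw [Measure.map_map (by fun_prop) measurable_fst, ← (hπ i).map_fst, ← hθ i,
      Measure.map_map measurable_fst (by fun_prop)]
    rfl
  · rw [← (hπ i).map_snd, ← hθ i, Measure.map_map measurable_snd (by fun_prop)]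
    rfl
  · have hm : ∀ j, Measurable fun z : (ι → E d) × E d => edist (z.1 j) z.2 ^ 2 := fun j =>
      measurable_edist_sq.comp (f := fun z : (ι → E d) × E d => (z.1 j, z.2)) (by fun_prop)
    have h1 : barycenterObjective w ρ ν =
        ∫⁻ z, ∑ j, ENNReal.ofReal (w j) * edist (z.1 j) z.2 ^ 2 ∂θ := by
      rw [lintegral_finsetSum _ fun j _ => (hm j).const_mul _]
      refine Finset.sum_congr rfl fun j _ => ?_
      rw [lintegral_const_mul _ (hm j), ← hopt j, ← hθ j, planCost,
        lintegral_map measurable_edist_sq (by fun_prop)]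
    -- Huygens' identity splits the integrand into the multi-marginal cost and the defect of `z.2`
    -- from the barycenter.
    have h2 : ∀ z : (ι → E d) × E d, ∑ j, ENNReal.ofReal (w j) * edist (z.1 j) z.2 ^ 2 =
        ENNReal.ofReal (∑ j, w j * ‖baryMap w z.1 - z.1 j‖ ^ 2) +
          edist z.2 (baryMap w z.1) ^ 2 := by
      intro z
      rw [sum_ofReal_mul_edist_sq hw0, sum_weight_norm_sub_sq hw,
        ENNReal.ofReal_add (Finset.sum_nonneg fun j _ => mul_nonneg (hw0 j) (by positivity))
          (by positivity), edist_sq_eq]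
    have hm2 : Measurable fun z : (ι → E d) × E d => edist z.2 (baryMap w z.1) ^ 2 :=
      (measurable_snd.edist (hb.comp measurable_fst)).pow_const 2
    have hm3 : Measurable fun x : ι → E d =>
        ENNReal.ofReal (∑ j, w j * ‖baryMap w x - x j‖ ^ 2) := by fun_prop
    rw [h1]
    simp_rw [h2]
    rw [lintegral_add_right _ hm2, multiMarginalCost, lintegral_map hm3 measurable_fst]

variable {w : ι → ℝ} {ρ : ι → Measure (E d)} {γ₀ : Measure (ι → E d)}

/-- A plan optimal for all pairs attains the lower bound `pairwiseCost`, which no coupling can beat.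
-/
theorem multiMarginalCost_le_of_pairwise_optimal (hw0 : ∀ j, 0 ≤ w j) (hw : ∑ j, w j = 1)
    (hopt : ∀ i j, planCost (pairMarginal γ₀ i j) = W2sq (ρ i) (ρ j)) {γ : Measure (ι → E d)}
    (hγ : γ ∈ multiCouplings ρ) : multiMarginalCost w γ₀ ≤ multiMarginalCost w γ := by
  have h := pairwiseCost_le hw0 hw hγ
  have h0 : 2 * multiMarginalCost w γ₀ = pairwiseCost w ρ := by
    rw [two_mul_multiMarginalCost hw0 hw, pairwiseCost]
    simp_rw [hopt]
  rw [← h0] at h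
  exact (ENNReal.mul_le_mul_iff_right (by simp) (by simp)).1 h

theorem isMultiMarginalBarycenter_of_pairwise_optimal (hw0 : ∀ j, 0 ≤ w j) (hw : ∑ j, w j = 1)
    (hγ₀ : γ₀ ∈ multiCouplings ρ)
    (hopt : ∀ i j, planCost (pairMarginal γ₀ i j) = W2sq (ρ i) (ρ j)) :
    IsMultiMarginalBarycenter w ρ (γ₀.map (baryMap w)) :=
  ⟨γ₀, hγ₀, fun _ h => multiMarginalCost_le_of_pairwise_optimal hw0 hw hopt h, rfl⟩

theorem memLp_id_map_baryMap (hγ₀ : γ₀ ∈ multiCouplings ρ) (hρ : ∀ i, MemLp id 2 (ρ i)) :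
    MemLp id 2 (γ₀.map (baryMap w)) := by
  have hb := measurable_baryMap (d := d) w
  rw [memLp_map_measure_iff aestronglyMeasurable_id hb.aemeasurable]
  change MemLp (fun x => ∑ j, w j • x j) 2 γ₀
  refine memLp_finsetSum _ fun j _ => ?_
  have hj : Measurable fun x : ι → E d => x j := measurable_pi_apply j
  have h : MemLp (fun x : ι → E d => x j) 2 γ₀ := by
    have h := hρ j
    rwa [← hγ₀ j, memLp_map_measure_iff aestronglyMeasurable_id hj.aemeasurable] at h
  exact h.const_smul (w j)

/-- The objective at the image of `γ₀` is at most the cost of `γ₀`, hence at most the cost of the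
plan glued from a competitor, which is at most the competitor's objective. -/
theorem isWassersteinBarycenter_of_pairwise_optimal [Nonempty ι]
    [∀ i, IsProbabilityMeasure (ρ i)] (hw0 : ∀ j, 0 ≤ w j) (hw : ∑ j, w j = 1)
    (hρ : ∀ i, MemLp id 2 (ρ i)) (hγ₀ : γ₀ ∈ multiCouplings ρ)
    (hopt : ∀ i j, planCost (pairMarginal γ₀ i j) = W2sq (ρ i) (ρ j)) :
    IsWassersteinBarycenter w ρ (γ₀.map (baryMap w)) := by
  have hb := measurable_baryMap (d := d) w
  have hprob : IsProbabilityMeasure γ₀ := by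
    obtain ⟨i⟩ := ‹Nonempty ι›
    refine ⟨?_⟩
    have := congrArg (fun m => m univ) (hγ₀ i)
    simpa [Measure.map_apply (measurable_pi_apply i) MeasurableSet.univ] using this
  refine ⟨Measure.isProbabilityMeasure_map hb.aemeasurable, memLp_id_map_baryMap hγ₀ hρ,
    fun ν hν _ => ?_⟩
  obtain ⟨θ, hθ, -, hobj⟩ := exists_plan_of_barycenterObjective (ρ := ρ) (ν := ν) hw0 hw
  calc barycenterObjective w ρ (γ₀.map (baryMap w)) ≤ multiMarginalCost w γ₀ :=
        barycenterObjective_map_le hw0 hγ₀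
    _ ≤ multiMarginalCost w (θ.map Prod.fst) :=
        multiMarginalCost_le_of_pairwise_optimal hw0 hw hopt hθ
    _ ≤ barycenterObjective w ρ ν := by rw [hobj]; exact le_self_add

theorem multiMarginalCost_ne_top [∀ i, IsProbabilityMeasure (ρ i)] (hw0 : ∀ j, 0 ≤ w j)
    (hw : ∑ j, w j = 1) (hρ : ∀ i, MemLp id 2 (ρ i)) {γ : Measure (ι → E d)}
    (hγ : γ ∈ multiCouplings ρ) : multiMarginalCost w γ ≠ ∞ := by
  have h : 2 * multiMarginalCost w γ ≠ ∞ := by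
    rw [two_mul_multiMarginalCost hw0 hw]
    exact ENNReal.sum_ne_top.2 fun i _ => ENNReal.sum_ne_top.2 fun j _ => ENNReal.mul_ne_top
      ENNReal.ofReal_ne_top ((isCoupling_pairMarginal hγ i j).planCost_lt_top (hρ i) (hρ j)).ne
  exact fun htop => h (by rw [htop]; simp)

/-- A Wasserstein barycenter is a barycenter in the multi-marginal sense. -/
theorem IsWassersteinBarycenter.isMultiMarginalBarycenter [Nonempty ι]
    [∀ i, IsProbabilityMeasure (ρ i)] (hw0 : ∀ j, 0 ≤ w j) (hw : ∑ j, w j = 1)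
    (hρ : ∀ i, MemLp id 2 (ρ i)) (hγ₀ : γ₀ ∈ multiCouplings ρ)
    (hopt : ∀ i j, planCost (pairMarginal γ₀ i j) = W2sq (ρ i) (ρ j)) {ν : Measure (E d)}
    (hν : IsWassersteinBarycenter w ρ ν) : IsMultiMarginalBarycenter w ρ ν := by
  have := hν.isProbabilityMeasure
  have hb := measurable_baryMap (d := d) w
  have hbar := isWassersteinBarycenter_of_pairwise_optimal hw0 hw hρ hγ₀ hopt
  have h1 : barycenterObjective w ρ ν ≤ multiMarginalCost w γ₀ :=
    (hν.le _ hbar.isProbabilityMeasure hbar.memLp).trans (barycenterObjective_map_le hw0 hγ₀)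
  obtain ⟨θ, hθ, hsnd, hobj⟩ := exists_plan_of_barycenterObjective (ρ := ρ) (ν := ν) hw0 hw
  have hmin : ∀ γ ∈ multiCouplings ρ, multiMarginalCost w (θ.map Prod.fst) ≤
      multiMarginalCost w γ := fun γ hγ => by
    refine le_trans ?_ (multiMarginalCost_le_of_pairwise_optimal hw0 hw hopt hγ)
    exact le_trans (by rw [hobj]; exact le_self_add) h1
  refine ⟨_, hθ, hmin, ?_⟩
  -- The objective at `ν` is at most the minimal multi-marginal cost, so no room is left for the
  -- defect. Hence `z.2` is almost surely the barycenter of `z.1`.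
  have hz : ∫⁻ z, edist z.2 (baryMap w z.1) ^ 2 ∂θ = 0 := by
    have h2 : multiMarginalCost w (θ.map Prod.fst) + ∫⁻ z, edist z.2 (baryMap w z.1) ^ 2 ∂θ ≤
        multiMarginalCost w (θ.map Prod.fst) + 0 := by
      rw [← hobj, add_zero]
      exact h1.trans (multiMarginalCost_le_of_pairwise_optimal hw0 hw hopt hθ)
    exact le_antisymm ((ENNReal.add_le_add_iff_left
      (multiMarginalCost_ne_top hw0 hw hρ hθ)).1 h2) bot_le
  have hm : Measurable fun z : (ι → E d) × E d => edist z.2 (baryMap w z.1) ^ 2 :=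
    (measurable_snd.edist (hb.comp measurable_fst)).pow_const 2
  rw [lintegral_eq_zero_iff hm] at hz
  rw [← hsnd inferInstance, Measure.map_map hb measurable_fst]
  refine Measure.map_congr ?_
  filter_upwards [hz] with z hz
  simpa using hz

/-- Uniqueness of the barycenter: if a measure of positive weight is absolutely continuous, the
plan is determined, on the coordinates of positive weight, by the optimal maps out of it. -/
theorem map_baryMap_eq_of_absolutelyContinuous [∀ i, IsProbabilityMeasure (ρ i)]
    (hw0 : ∀ j, 0 ≤ w j) (hw : ∑ j, w j = 1) (hρ : ∀ i, MemLp id 2 (ρ i))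
    {k : ι} (hk : 0 < w k) (hac : ρ k ≪ volume) {S : ι → E d → E d}
    (hS : ∀ i, IsOptimalTransportMap (S i) (ρ k) (ρ i)) {γ : Measure (ι → E d)}
    (hγ : γ ∈ multiCouplings ρ) (hcost : 2 * multiMarginalCost w γ ≤ pairwiseCost w ρ) :
    γ.map (baryMap w) = (ρ k).map fun x => ∑ i, w i • S i x := by
  have hgr : ∀ i, 0 < w i → ∀ᵐ x ∂γ, x i = S i (x k) := by
    intro i hi
    have hpair : pairMarginal γ k i = (ρ k).map fun x => (x, S i x) :=
      optimal_coupling_eq hac (W2sq_lt_top (hρ k) (hρ i)).ne (isCoupling_pairMarginal hγ k i)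
        (planCost_pairMarginal_eq hw0 hw hρ hγ hcost hk hi) (hS i)
    have hSm := (hS i).aemeasurable
    -- `S i` is only almost everywhere measurable. A measurable representative is needed for its
    -- graph to be a measurable set.
    set S' := hSm.mk (S i) with hS'
    have hgraph : MeasurableSet {p : E d × E d | p.2 = S' p.1} :=
      measurableSet_eq_fun measurable_snd (hSm.measurable_mk.comp measurable_fst)
    have h1 : ∀ᵐ p ∂(pairMarginal γ k i), p.2 = S' p.1 := by
      rw [hpair, ae_map_iff (aemeasurable_id'.prodMk hSm) hgraph]
      exact hSm.ae_eq_mk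
    have h2 := ae_of_ae_map (by fun_prop) h1
    have h3 : ∀ᵐ x ∂γ, S i (x k) = S' (x k) := by
      have h4 : ∀ᵐ x ∂(γ.map fun x => x k), S i x = S' x := by
        rw [hγ k]; exact hSm.ae_eq_mk
      exact ae_of_ae_map (measurable_pi_apply k).aemeasurable h4
    filter_upwards [h2, h3] with x h2 h3
    rw [h3]; exact h2
  have hall : ∀ᵐ x ∂γ, baryMap w x = ∑ i, w i • S i (x k) := by
    have : ∀ i, ∀ᵐ x ∂γ, w i • x i = w i • S i (x k) := by
      intro i
      -- The cost does not constrain coordinates of zero weight, but they do not enter the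
      -- barycenter either.
      rcases (hw0 i).eq_or_lt with h | h
      · simp [← h]
      · filter_upwards [hgr i h] with x hx
        rw [← hx]
    filter_upwards [ae_all_iff.2 this] with x hx
    exact Finset.sum_congr rfl fun i _ => hx i
  have hm : AEMeasurable (fun x => ∑ i, w i • S i x) (γ.map fun x => x k) := by
    rw [hγ k]
    exact Finset.aemeasurable_fun_sum _ fun i _ => (hS i).aemeasurable.fun_const_smul (w i)
  rw [Measure.map_congr hall, ← hγ k]
  exact (AEMeasurable.map_map_of_aemeasurable hm (measurable_pi_apply k).aemeasurable).symm

/-- An optimal plan and `γ₀` both attain `pairwiseCost`, so their images have the same expression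
through the maps `S i` out of `ρ k`. -/
theorem IsMultiMarginalBarycenter.eq_of_absolutelyContinuous
    [∀ i, IsProbabilityMeasure (ρ i)] (hw0 : ∀ j, 0 ≤ w j) (hw : ∑ j, w j = 1)
    (hρ : ∀ i, MemLp id 2 (ρ i)) (hγ₀ : γ₀ ∈ multiCouplings ρ)
    (hopt : ∀ i j, planCost (pairMarginal γ₀ i j) = W2sq (ρ i) (ρ j))
    {k : ι} (hk : 0 < w k) (hac : ρ k ≪ volume) {S : ι → E d → E d}
    (hS : ∀ i, IsOptimalTransportMap (S i) (ρ k) (ρ i)) {ν : Measure (E d)}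
    (hν : IsMultiMarginalBarycenter w ρ ν) : ν = γ₀.map (baryMap w) := by
  obtain ⟨γ, hγ, hmin, rfl⟩ := hν
  have h0 : 2 * multiMarginalCost w γ₀ = pairwiseCost w ρ := by
    rw [two_mul_multiMarginalCost hw0 hw, pairwiseCost]
    simp_rw [hopt]
  rw [map_baryMap_eq_of_absolutelyContinuous hw0 hw hρ hk hac hS hγ
      (by rw [← h0]; gcongr; exact hmin _ hγ₀),
    map_baryMap_eq_of_absolutelyContinuous hw0 hw hρ hk hac hS hγ₀ h0.le]

end Barycenter

/-! ### Gaussian mixtures and their limit as the noise vanishes -/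

section Gaussian

variable {d : ℕ}

theorem gaussDensity_nonneg (σ : ℝ) (m x : E d) : 0 ≤ gaussDensity σ m x := by
  unfold gaussDensity; positivity

theorem gaussDensity_pos {σ : ℝ} (hσ : 0 < σ) (m x : E d) : 0 < gaussDensity σ m x := by
  have := Real.pi_pos
  unfold gaussDensity; positivity

theorem gaussDensity_eq_sub (σ : ℝ) (m x : E d) : gaussDensity σ m x = gaussDensity σ 0 (x - m) := by
  simp [gaussDensity]

theorem continuous_gaussDensity (σ : ℝ) : Continuous (gaussDensity σ (0 : E d)) := by
  unfold gaussDensity; fun_prop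

theorem gaussDensity_le (σ : ℝ) (m x : E d) :
    gaussDensity σ m x ≤ (Real.sqrt (2 * Real.pi * σ ^ 2) ^ d)⁻¹ := by
  unfold gaussDensity
  refine mul_le_of_le_one_right (by positivity) (Real.exp_le_one_iff.2 ?_)
  exact div_nonpos_of_nonpos_of_nonneg (by simp) (by positivity)

theorem lintegral_gaussDensity {σ : ℝ} (hσ : 0 < σ) :
    ∫⁻ x : E d, ENNReal.ofReal (gaussDensity σ 0 x) = 1 := by
  have hpi := Real.pi_pos
  have hb : 0 < 1 / (2 * σ ^ 2) := by positivity
  have hexp : ∀ x : E d, gaussDensity σ 0 x =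
      (Real.sqrt (2 * Real.pi * σ ^ 2) ^ d)⁻¹ * Real.exp (-(1 / (2 * σ ^ 2)) * ‖x‖ ^ 2) := by
    intro x
    simp only [gaussDensity, sub_zero]
    congr 2
    ring
  have hval : ∫ x : E d, Real.exp (-(1 / (2 * σ ^ 2)) * ‖x‖ ^ 2) =
      Real.sqrt (2 * Real.pi * σ ^ 2) ^ d := by
    rw [GaussianFourier.integral_rexp_neg_mul_sq_norm hb, finrank_euclideanSpace_fin,
      Real.sqrt_eq_rpow, ← Real.rpow_mul_natCast (by positivity)]
    congr 1
    · field_simp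
    · ring
  -- The Bochner integral of a non-integrable function is zero, while the value just computed is
  -- positive.
  have hint : Integrable fun x : E d => Real.exp (-(1 / (2 * σ ^ 2)) * ‖x‖ ^ 2) := by
    by_contra h
    rw [integral_undef h] at hval
    have : 0 < Real.sqrt (2 * Real.pi * σ ^ 2) ^ d := by positivity
    exact this.ne hval
  rw [← ofReal_integral_eq_lintegral_ofReal]
  · simp_rw [hexp]
    rw [integral_const_mul, hval, inv_mul_cancel₀ (by positivity), ENNReal.ofReal_one]
  · exact (hint.const_mul _).congr (Eventually.of_forall fun x => (hexp x).symm)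
  · exact Eventually.of_forall fun x => gaussDensity_nonneg σ 0 x

/-- The standard Gaussian measure on `ℝᵈ`. -/
noncomputable def stdGauss (d : ℕ) : Measure (E d) :=
  volume.withDensity fun x => ENNReal.ofReal (gaussDensity 1 0 x)

instance : IsProbabilityMeasure (stdGauss d) :=
  ⟨by rw [stdGauss, withDensity_apply _ MeasurableSet.univ, Measure.restrict_univ,
    lintegral_gaussDensity one_pos]⟩

theorem measurable_ofReal_gaussDensity (σ : ℝ) :
    Measurable fun x : E d => ENNReal.ofReal (gaussDensity σ 0 x) :=
  (continuous_gaussDensity σ).measurable.ennreal_ofReal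

theorem lintegral_stdGauss_smul {σ : ℝ} (hσ : 0 < σ) {f : E d → ℝ≥0∞} (hf : Measurable f) :
    ∫⁻ y, f (σ • y) ∂(stdGauss d) = ∫⁻ x, f x * ENNReal.ofReal (gaussDensity σ 0 x) := by
  have hpi := Real.pi_pos
  have hm := measurable_ofReal_gaussDensity (d := d)
  rw [stdGauss, lintegral_withDensity_eq_lintegral_mul _ (hm 1)
    (g := fun y => f (σ • y)) (hf.comp (by fun_prop))]
  have hscale : ∀ y : E d, ENNReal.ofReal (gaussDensity 1 0 y) =
      ENNReal.ofReal (σ ^ d) * ENNReal.ofReal (gaussDensity σ 0 (σ • y)) := by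
    intro y
    rw [← ENNReal.ofReal_mul (by positivity)]
    congr 1
    simp only [gaussDensity, sub_zero, norm_smul, Real.norm_eq_abs, abs_of_pos hσ, one_pow, mul_one]
    rw [Real.sqrt_mul (by positivity : 0 ≤ 2 * Real.pi) (σ ^ 2), Real.sqrt_sq hσ.le, mul_pow _ σ, mul_inv]
    have h1 : -(σ * ‖y‖) ^ 2 / (2 * σ ^ 2) = -‖y‖ ^ 2 / 2 := by field_simp
    rw [h1]
    field_simp
  let F : E d → ℝ≥0∞ := fun x => f x * ENNReal.ofReal (gaussDensity σ 0 x)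
  have hF : Measurable F := hf.mul (hm σ)
  have h1 : ∀ y : E d, ENNReal.ofReal (gaussDensity 1 0 y) * f (σ • y) =
      ENNReal.ofReal (σ ^ d) * F (σ • y) := by
    intro y
    simp only [hscale, F]
    ring
  have h2 : ∫⁻ y, F (σ • y) = ENNReal.ofReal (σ ^ d)⁻¹ * ∫⁻ x, F x := by
    have := Measure.map_addHaar_smul (volume : Measure (E d)) hσ.ne'
    rw [finrank_euclideanSpace_fin, abs_of_pos (by positivity)] at this
    rw [← smul_eq_mul, ← lintegral_smul_measure, ← this, lintegral_map hF (by fun_prop)]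
  calc _ = ∫⁻ y, ENNReal.ofReal (σ ^ d) * F (σ • y) := lintegral_congr h1
    _ = ENNReal.ofReal (σ ^ d) * (ENNReal.ofReal (σ ^ d)⁻¹ * ∫⁻ x, F x) := by
      rw [lintegral_const_mul' _ _ ENNReal.ofReal_ne_top, h2]
    _ = ∫⁻ x, F x := by
      rw [← mul_assoc, ← ENNReal.ofReal_mul (by positivity), mul_inv_cancel₀ (by positivity),
        ENNReal.ofReal_one, one_mul]

variable {Z : Type*} [MeasurableSpace Z]

theorem integrable_gaussDensity_comp (q : Measure Z) [IsFiniteMeasure q] (σ : ℝ) {m : Z → E d}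
    (hm : Measurable m) (x : E d) : Integrable (fun z => gaussDensity σ (m z) x) q := by
  refine Integrable.of_bound (C := (Real.sqrt (2 * Real.pi * σ ^ 2) ^ d)⁻¹) ?_
    (Eventually.of_forall fun z => ?_)
  · simp_rw [gaussDensity_eq_sub σ (m _)]
    exact ((continuous_gaussDensity σ).measurable.comp (by fun_prop)).aestronglyMeasurable
  · rw [Real.norm_of_nonneg (gaussDensity_nonneg _ _ _)]
    exact gaussDensity_le _ _ _

/-- A mixture of isotropic Gaussians is the law of a random centre plus Gaussian noise. -/
theorem withDensity_mixture_eq_map (q : Measure Z) [IsProbabilityMeasure q] {σ : ℝ} (hσ : 0 < σ)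
    {m : Z → E d} (hm : Measurable m) :
    volume.withDensity (fun x => ENNReal.ofReal (∫ z, gaussDensity σ (m z) x ∂q)) =
      (q.prod (stdGauss d)).map fun p => m p.1 + σ • p.2 := by
  have hGz : ∀ x : E d, Measurable fun z => ENNReal.ofReal (gaussDensity σ (m z) x) := fun x => by
    simp_rw [gaussDensity_eq_sub σ (m _)]
    exact (measurable_ofReal_gaussDensity σ).comp (by fun_prop)
  have hG : Measurable fun p : Z × E d => ENNReal.ofReal (gaussDensity σ (m p.1) p.2) := by
    simp_rw [gaussDensity_eq_sub σ (m _)]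
    exact (measurable_ofReal_gaussDensity σ).comp (by fun_prop)
  have hdens : ∀ x, ENNReal.ofReal (∫ z, gaussDensity σ (m z) x ∂q) =
      ∫⁻ z, ENNReal.ofReal (gaussDensity σ (m z) x) ∂q := fun x =>
    ofReal_integral_eq_lintegral_ofReal (integrable_gaussDensity_comp q σ hm x)
      (Eventually.of_forall fun z => gaussDensity_nonneg _ _ _)
  have hdm : Measurable fun x : E d => ∫⁻ z, ENNReal.ofReal (gaussDensity σ (m z) x) ∂q :=
    hG.lintegral_prod_left'
  have hmap : Measurable fun p : Z × E d => m p.1 + σ • p.2 := by fun_prop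
  simp_rw [hdens]
  refine Measure.ext_of_lintegral _ fun f hf => ?_
  rw [lintegral_map hf hmap, lintegral_prod (fun p : Z × E d => f (m p.1 + σ • p.2))
      (hf.comp hmap).aemeasurable,
    lintegral_withDensity_eq_lintegral_mul _ hdm hf]
  have h1 : ∀ z, ∫⁻ y, f (m z + σ • y) ∂(stdGauss d) =
      ∫⁻ x, f x * ENNReal.ofReal (gaussDensity σ (m z) x) := by
    intro z
    rw [lintegral_stdGauss_smul hσ (f := fun x => f (m z + x)) (hf.comp (by fun_prop))]
    rw [← lintegral_add_left_eq_self (fun x => f x * ENNReal.ofReal (gaussDensity σ (m z) x)) (m z)]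
    refine lintegral_congr fun x => ?_
    rw [gaussDensity_eq_sub σ (m z), add_sub_cancel_left]
  simp_rw [h1]
  rw [lintegral_lintegral_swap]
  · refine lintegral_congr fun x => ?_
    rw [lintegral_const_mul _ (hGz x), Pi.mul_apply, mul_comm]
  · exact ((hf.comp measurable_snd).mul hG).aemeasurable

/-- The mixtures are realized as the laws of `m + σ y` on one probability space independent of `σ`.
There `f (m + σ y)` converges pointwise and is bounded by `‖f‖`. -/
theorem tendsto_integral_mixture (q : Measure Z) [IsProbabilityMeasure q] {m : Z → E d}
    (hm : Measurable m) (f : E d →ᵇ ℝ) :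
    Tendsto (fun σ : ℝ => ∫ x, f x
      ∂(volume.withDensity fun x => ENNReal.ofReal (∫ z, gaussDensity σ (m z) x ∂q)))
      (𝓝[>] 0) (𝓝 (∫ x, f x ∂(q.map m))) := by
  have h1 : (fun σ : ℝ => ∫ p, f (m p.1 + σ • p.2) ∂(q.prod (stdGauss d))) =ᶠ[𝓝[>] 0]
      fun σ : ℝ => ∫ x, f x
        ∂(volume.withDensity fun x => ENNReal.ofReal (∫ z, gaussDensity σ (m z) x ∂q)) := by
    filter_upwards [self_mem_nhdsWithin] with σ hσ
    rw [withDensity_mixture_eq_map q hσ hm, integral_map (by fun_prop)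
      f.continuous.aestronglyMeasurable]
  refine Tendsto.congr' h1 ?_
  have h2 : ∫ x, f x ∂(q.map m) = ∫ p, f (m p.1) ∂(q.prod (stdGauss d)) := by
    rw [integral_map hm.aemeasurable f.continuous.aestronglyMeasurable]
    have h3 : q = (q.prod (stdGauss d)).map Prod.fst := measurePreserving_fst.map_eq.symm
    conv_lhs => rw [h3]
    rw [integral_map measurable_fst.aemeasurable]
    exact (f.continuous.measurable.comp hm).aestronglyMeasurable
  rw [h2]
  refine tendsto_integral_filter_of_dominated_convergence (fun _ => ‖f‖) ?_ ?_ (integrable_const _) ?_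
  · exact Eventually.of_forall fun σ =>
      (f.continuous.measurable.comp (by fun_prop)).aestronglyMeasurable
  · exact Eventually.of_forall fun σ => Eventually.of_forall fun p => f.norm_coe_le_norm _
  · refine Eventually.of_forall fun p => ?_
    have : Continuous fun σ : ℝ => f (m p.1 + σ • p.2) := by fun_prop
    have h := (this.tendsto 0).mono_left (nhdsWithin_le_nhds (s := Ioi 0))
    simpa using h

/-- The centre `z_{t,s}` of the conditional path of the latent variable `z = (a, b, c)`. -/
def latentPath (t s : ℝ) (z : E d × E d × E d) : E d :=
  z.1 + t • (z.2.1 - z.1) + s • (z.2.2 - z.1)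

theorem measurable_latentPath (t s : ℝ) : Measurable (latentPath (d := d) t s) := by
  unfold latentPath; fun_prop

theorem marginal_eq (q : Measure (E d × E d × E d)) (σ t s : ℝ) : marginal q σ t s =
    volume.withDensity fun x => ENNReal.ofReal (∫ z, gaussDensity σ (latentPath t s z) x ∂q) :=
  rfl

theorem isProbabilityMeasure_marginal (q : Measure (E d × E d × E d)) [IsProbabilityMeasure q]
    {σ : ℝ} (hσ : 0 < σ) (t s : ℝ) : IsProbabilityMeasure (marginal q σ t s) := by
  have := measurable_latentPath (d := d) t s
  rw [marginal_eq, withDensity_mixture_eq_map q hσ this]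
  exact Measure.isProbabilityMeasure_map (by fun_prop)

theorem tendsto_integral_marginal (q : Measure (E d × E d × E d)) [IsProbabilityMeasure q]
    (t s : ℝ) (f : E d →ᵇ ℝ) :
    Tendsto (fun σ : ℝ => ∫ x, f x ∂(marginal q σ t s)) (𝓝[>] 0)
      (𝓝 (∫ x, f x ∂(q.map (latentPath t s)))) :=
  tendsto_integral_mixture q (measurable_latentPath t s) f

end Gaussian

/-! ### Convergence of the explicit Euler scheme along a given solution -/

section EulerScheme

variable {V : Type*} [NormedAddCommGroup V] [NormedSpace ℝ V]

/-- The iterates of the explicit Euler scheme with step `h` for `x' = w (τ, x)`. -/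
def eulerIter (w : ℝ × V → V) (h : ℝ) : ℕ → V → V
  | 0, x => x
  | k + 1, x => eulerIter w h k x + h • w (k * h, eulerIter w h k x)

theorem continuous_eulerIter {w : ℝ × V → V} (hw : Continuous w) (h : ℝ) (k : ℕ) :
    Continuous (eulerIter w h k) := by
  induction k with
  | zero => exact continuous_id
  | succ k ih => simp only [eulerIter]; fun_prop

/-- A solution of `x' = g` agrees with its tangent step up to the oscillation of `g`. -/
theorem norm_sub_step_le {X g : ℝ → V} {τ h η : ℝ} (h0 : 0 ≤ h)
    (hX : ∀ r ∈ Icc τ (τ + h), HasDerivWithinAt X (g r) (Icc τ (τ + h)) r)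
    (hg : ∀ r ∈ Icc τ (τ + h), ‖g r - g τ‖ ≤ η) : ‖X (τ + h) - X τ - h • g τ‖ ≤ η * h := by
  have hd : ∀ r ∈ Icc τ (τ + h),
      HasDerivWithinAt (fun r => X r - r • g τ) (g r - g τ) (Icc τ (τ + h)) r := by
    intro r hr
    have h1 := ((hasDerivAt_id r).smul_const (g τ)).hasDerivWithinAt (s := Icc τ (τ + h))
    simpa using (hX r hr).fun_sub h1
  have := (convex_Icc τ (τ + h)).norm_image_sub_le_of_norm_hasDerivWithin_le hd hg
    (left_mem_Icc.2 (by linarith)) (right_mem_Icc.2 (by linarith))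
  rw [add_sub_cancel_left, Real.norm_of_nonneg h0] at this
  convert this using 2
  rw [add_smul]
  abel

/-- Convergence of the Euler scheme along a solution, together with a uniform bound. -/
theorem eventually_eulerIter_near {w : ℝ × V → V} {X : ℝ → V} (hw : Continuous w)
    (hlip : ∀ R : ℝ, ∃ L : ℝ, 0 ≤ L ∧ ∀ τ ∈ Icc (0 : ℝ) 1, ∀ x ∈ Metric.closedBall (0 : V) R,
      ∀ y ∈ Metric.closedBall (0 : V) R, ‖w (τ, x) - w (τ, y)‖ ≤ L * ‖x - y‖)
    (hX : ∀ τ ∈ Icc (0 : ℝ) 1, HasDerivWithinAt X (w (τ, X τ)) (Icc 0 1) τ) {t : ℝ}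
    (ht : t ∈ Icc (0 : ℝ) 1) :
    ∃ R : ℝ, ∀ ε > 0, ∀ᶠ n : ℕ in atTop, (∀ k ≤ n, ‖eulerIter w (t / n) k (X 0)‖ ≤ R) ∧
      ‖eulerIter w (t / n) n (X 0) - X t‖ ≤ ε := by
  have hXc : ContinuousOn X (Icc 0 1) := fun τ hτ => (hX τ hτ).continuousWithinAt
  obtain ⟨R, hR⟩ := (isCompact_Icc.image_of_continuousOn hXc).isBounded.exists_norm_le
  have hXR : ∀ τ ∈ Icc (0 : ℝ) 1, ‖X τ‖ ≤ R := fun τ hτ => hR _ (mem_image_of_mem X hτ)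
  -- The field is only locally Lipschitz. The extra unit of radius suffices because the iterates
  -- stay within distance one of the solution.
  obtain ⟨L, hL0, hL⟩ := hlip (R + 1)
  refine ⟨R + 1, fun ε hε => ?_⟩
  -- Gronwall amplifies the local error `η` by at most `exp L` on the unit interval, so this choice
  -- keeps the total error below both `1` and `ε`.
  set η : ℝ := min 1 ε * Real.exp (-L) with hη
  have hη0 : 0 < η := by positivity
  have hηexp : η * Real.exp L = min 1 ε := by
    rw [hη, mul_assoc, ← Real.exp_add]; simp
  have hgc : ContinuousOn (fun τ => w (τ, X τ)) (Icc 0 1) :=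
    hw.comp_continuousOn (continuousOn_id.prodMk hXc)
  have huc := isCompact_Icc.uniformContinuousOn_of_continuous hgc
  obtain ⟨δ, hδ, hosc⟩ := Metric.uniformContinuousOn_iff_le.1 huc η hη0
  obtain ⟨n₀, hn₀⟩ := exists_nat_ge (1 / δ)
  filter_upwards [eventually_ge_atTop (n₀ + 1)] with n hn
  have hnpos : (0 : ℝ) < n := by
    have : 0 < n := by omega
    exact_mod_cast this
  set h : ℝ := t / n with hh
  have h0 : 0 ≤ h := div_nonneg ht.1 hnpos.le
  have hnh : n * h = t := by rw [hh]; field_simp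
  have hhδ : h ≤ δ := by
    have h1 : (n₀ : ℝ) ≤ n := by
      have : n₀ ≤ n := by omega
      exact_mod_cast this
    rw [hh, div_le_iff₀ hnpos]
    have : 1 ≤ n₀ * δ := by rwa [div_le_iff₀ hδ] at hn₀
    nlinarith [ht.2]
  have hkmem : ∀ k : ℕ, k ≤ n → (k : ℝ) * h ∈ Icc (0 : ℝ) 1 := fun k hk => by
    have : (k : ℝ) ≤ n := by exact_mod_cast hk
    exact ⟨by positivity, by nlinarith [ht.2]⟩
  -- Discrete Gronwall: a step multiplies the error by `1 + L h ≤ exp (L h)` and adds at most `η h`.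
  have herr : ∀ k : ℕ, k ≤ n →
      ‖eulerIter w h k (X 0) - X (k * h)‖ ≤ η * (k * h) * Real.exp (L * (k * h)) := by
    intro k
    induction k with
    | zero => intro _; simp [eulerIter]
    | succ k ih =>
      intro hk
      have hk' : k ≤ n := by omega
      have hτ := hkmem k hk'
      have hτ' := hkmem (k + 1) hk
      push_cast at hτ'
      have hτh : (k + 1 : ℝ) * h = k * h + h := by ring
      have herrk := ih hk'
      set y := eulerIter w h k (X 0) with hy
      have hsub : Icc (k * h) (k * h + h) ⊆ Icc (0 : ℝ) 1 :=
        Icc_subset_Icc hτ.1 (by rw [← hτh]; exact hτ'.2)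
      have hstep : ‖X (k * h + h) - X (k * h) - h • w (k * h, X (k * h))‖ ≤ η * h := by
        refine norm_sub_step_le (g := fun τ => w (τ, X τ)) h0
          (fun r hr => (hX r (hsub hr)).mono hsub) fun r hr => ?_
        rw [← dist_eq_norm]
        refine hosc r (hsub hr) _ hτ ?_
        rw [Real.dist_eq, abs_of_nonneg (by linarith [hr.1])]
        linarith [hr.2]
      have hle1 : ‖y - X (k * h)‖ ≤ 1 := by
        refine herrk.trans ?_
        calc η * (k * h) * Real.exp (L * (k * h)) ≤ η * 1 * Real.exp (L * 1) := by
              gcongr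
              · exact hτ.2
              · exact hτ.2
          _ = min 1 ε := by rw [mul_one, mul_one, hηexp]
          _ ≤ 1 := min_le_left _ _
      have hyR : y ∈ Metric.closedBall (0 : V) (R + 1) := by
        rw [mem_closedBall_zero_iff]
        have := norm_add_le (y - X (k * h)) (X (k * h))
        rw [sub_add_cancel] at this
        linarith [hXR _ hτ]
      have hXR' : X (k * h) ∈ Metric.closedBall (0 : V) (R + 1) := by
        rw [mem_closedBall_zero_iff]
        linarith [hXR _ hτ]
      have hw' := hL _ hτ _ hyR _ hXR'
      have hexp1 : 1 + L * h ≤ Real.exp (L * h) := by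
        linarith [Real.add_one_le_exp (L * h)]
      have hexp2 : Real.exp (L * ((k + 1 : ℝ) * h)) = Real.exp (L * (k * h)) * Real.exp (L * h) := by
        rw [← Real.exp_add]; ring_nf
      have hexp3 : 1 ≤ Real.exp (L * ((k + 1 : ℝ) * h)) := Real.one_le_exp (mul_nonneg hL0 hτ'.1)
      simp only [eulerIter]
      push_cast
      rw [← hy, hτh]
      calc ‖y + h • w (k * h, y) - X (k * h + h)‖
          = ‖(y - X (k * h)) + h • (w (k * h, y) - w (k * h, X (k * h))) -
              (X (k * h + h) - X (k * h) - h • w (k * h, X (k * h)))‖ := by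
            congr 1; rw [smul_sub]; abel
        _ ≤ ‖y - X (k * h)‖ + h * (L * ‖y - X (k * h)‖) + η * h := by
            refine (norm_sub_le _ _).trans (add_le_add ((norm_add_le _ _).trans ?_) hstep)
            rw [norm_smul, Real.norm_of_nonneg h0]
            gcongr
        _ = (1 + L * h) * ‖y - X (k * h)‖ + η * h := by ring
        _ ≤ Real.exp (L * h) * (η * (k * h) * Real.exp (L * (k * h))) +
              η * h * Real.exp (L * ((k + 1 : ℝ) * h)) := by
            exact add_le_add (mul_le_mul hexp1 herrk (norm_nonneg _) (Real.exp_nonneg _))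
              (le_mul_of_one_le_right (mul_nonneg hη0.le h0) hexp3)
        _ = η * (k * h + h) * Real.exp (L * (k * h + h)) := by
            rw [← hτh, hexp2]; ring
  have hbd : ∀ k : ℕ, k ≤ n → ‖eulerIter w h k (X 0) - X (k * h)‖ ≤ min 1 ε := fun k hk => by
    have hτ := hkmem k hk
    refine (herr k hk).trans ?_
    calc η * (k * h) * Real.exp (L * (k * h)) ≤ η * 1 * Real.exp (L * 1) := by
          gcongr
          · exact hτ.2
          · exact hτ.2
      _ = min 1 ε := by rw [mul_one, mul_one, hηexp]
  refine ⟨fun k hk => ?_, ?_⟩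
  · have h1 := (hbd k hk).trans (min_le_left _ _)
    have h2 := norm_add_le (eulerIter w h k (X 0) - X (k * h)) (X (k * h))
    rw [sub_add_cancel] at h2
    linarith [hXR _ (hkmem k hk)]
  · have h1 := (hbd n le_rfl).trans (min_le_right _ _)
    rwa [hnh] at h1

end EulerScheme

/-! ### The determinant near the identity -/

section Determinant

variable {d : ℕ}

theorem contDiff_det : ContDiff ℝ 1 fun A : E d →L[ℝ] E d => A.det := by
  let b := (EuclideanSpace.basisFun (Fin d) ℝ).toBasis
  have h : (fun A : E d →L[ℝ] E d => A.det) = fun A => ∑ σ : Equiv.Perm (Fin d),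
      ((Equiv.Perm.sign σ : ℤ) : ℝ) * ∏ i, (A (b i)) (σ i) := by
    funext A
    rw [ContinuousLinearMap.det, ← LinearMap.det_toMatrix b, Matrix.det_apply']
    simp [LinearMap.toMatrix_apply, b]
  rw [h]
  refine ContDiff.sum fun σ _ => contDiff_const.mul (contDiff_prod fun i _ => ?_)
  exact ((EuclideanSpace.proj (σ i) : E d →L[ℝ] ℝ).comp
    (ContinuousLinearMap.apply ℝ (E d) (b i))).contDiff

/-- The derivative of `h ↦ det (1 + h A)`. -/
noncomputable def detDeriv (A : E d →L[ℝ] E d) (h : ℝ) : ℝ :=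
  fderiv ℝ (fun A : E d →L[ℝ] E d => A.det) (1 + h • A) A

theorem hasDerivAt_det_one_add (A : E d →L[ℝ] E d) (h : ℝ) :
    HasDerivAt (fun h : ℝ => (1 + h • A).det) (detDeriv A h) h := by
  have h1 := (contDiff_det (d := d)).differentiable one_ne_zero (1 + h • A)
  have h2 : HasDerivAt (fun h : ℝ => 1 + h • A) A h := by
    simpa using ((hasDerivAt_id h).smul_const A).const_add 1
  exact h1.hasFDerivAt.comp_hasDerivAt h h2

theorem continuous_detDeriv : Continuous fun p : (E d →L[ℝ] E d) × ℝ => detDeriv p.1 p.2 := by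
  have := (contDiff_det (d := d)).continuous_fderiv one_ne_zero
  unfold detDeriv
  exact (this.comp (by fun_prop)).clm_apply (by fun_prop)

theorem detDeriv_zero (A : E d →L[ℝ] E d) : detDeriv A 0 = LinearMap.trace ℝ (E d) A := by
  let b := (EuclideanSpace.basisFun (Fin d) ℝ).toBasis
  let M := LinearMap.toMatrix b b A
  -- Dividing twice by `X` strips the constant and linear coefficients, which leaves the cofactor of
  -- `h ^ 2` in `det (1 + h A)`.
  let Q : Polynomial ℝ :=
    (1 + (Polynomial.X : Polynomial ℝ) • M.map Polynomial.C).det.divX.divX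
  have hdet : (fun h : ℝ => (1 + h • A).det) = fun h => 1 + M.trace * h + Q.eval h * h ^ 2 := by
    funext h
    rw [← Matrix.det_one_add_smul, ContinuousLinearMap.det, ← LinearMap.det_toMatrix b]
    congr 1
    simp only [M]
    rw [← map_smul, ← LinearMap.toMatrix_one b, ← map_add]
    rfl
  have h1 := hasDerivAt_det_one_add A 0
  rw [hdet] at h1
  have h2 : HasDerivAt (fun h : ℝ => 1 + M.trace * h + Q.eval h * h ^ 2) M.trace 0 := by
    have h3 := ((hasDerivAt_id (0 : ℝ)).const_mul M.trace).const_add 1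
    have h4 := (Q.hasDerivAt 0).mul ((hasDerivAt_id (0 : ℝ)).pow 2)
    convert! h3.add h4 using 1
    simp
  rw [h1.unique h2, LinearMap.trace_eq_matrix_trace ℝ b]

end Determinant

/-! ### The continuity equation and transport along characteristics -/

section Transport

variable {d : ℕ}

/-- The derivative in space of a time-dependent vector field. -/
noncomputable def spatialDeriv (w : ℝ × E d → E d) (z : ℝ × E d) : E d →L[ℝ] E d :=
  (fderiv ℝ w z).comp (ContinuousLinearMap.inr ℝ ℝ (E d))

/-- The positive `C¹` density `p` is transported by the `C¹` field `w`: it solves the continuity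
equation `∂ₜ p + w · ∇ p + p div w = 0`. -/
structure SolvesContinuityEq (p : ℝ × E d → ℝ) (w : ℝ × E d → E d) : Prop where
  pos : ∀ z, 0 < p z
  contDiff_density : ContDiff ℝ 1 p
  contDiff_field : ContDiff ℝ 1 w
  eq_zero : ∀ z, fderiv ℝ p z (1, w z) + p z * LinearMap.trace ℝ (E d) (spatialDeriv w z) = 0

variable {p : ℝ × E d → ℝ} {w : ℝ × E d → E d}

theorem continuous_spatialDeriv (hw : ContDiff ℝ 1 w) : Continuous (spatialDeriv w) := by
  have := hw.continuous_fderiv one_ne_zero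
  unfold spatialDeriv
  fun_prop

theorem hasFDerivAt_spatial (hw : ContDiff ℝ 1 w) (τ : ℝ) (x : E d) :
    HasFDerivAt (fun x => w (τ, x)) (spatialDeriv w (τ, x)) x := by
  have h1 := (hw.differentiable one_ne_zero (τ, x)).hasFDerivAt
  have h2 : HasFDerivAt (fun x : E d => (τ, x)) (ContinuousLinearMap.inr ℝ ℝ (E d)) x :=
    hasFDerivAt_prodMk_right τ x
  exact h1.comp x h2

theorem exists_lipschitz_on_ball (hw : ContDiff ℝ 1 w) (R : ℝ) : ∃ L : ℝ, 0 ≤ L ∧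
    ∀ τ ∈ Icc (0 : ℝ) 1, ∀ x ∈ Metric.closedBall (0 : E d) R,
      ∀ y ∈ Metric.closedBall (0 : E d) R, ‖w (τ, x) - w (τ, y)‖ ≤ L * ‖x - y‖ := by
  have hK : IsCompact (Icc (0 : ℝ) 1 ×ˢ Metric.closedBall (0 : E d) R) :=
    isCompact_Icc.prod (isCompact_closedBall _ _)
  obtain ⟨L, hL⟩ := hK.exists_bound_of_continuousOn (continuous_spatialDeriv hw).continuousOn
  refine ⟨max L 0, le_max_right _ _, fun τ hτ x hx y hy => ?_⟩
  have hbd : ∀ z ∈ Metric.closedBall (0 : E d) R, ‖spatialDeriv w (τ, z)‖ ≤ max L 0 :=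
    fun z hz => (hL (τ, z) ⟨hτ, hz⟩).trans (le_max_left _ _)
  exact (convex_closedBall (0 : E d) R).norm_image_sub_le_of_norm_hasFDerivWithin_le
    (f := fun x => w (τ, x)) (fun z _ => (hasFDerivAt_spatial hw τ z).hasFDerivWithinAt) hbd hy hx

/-- The density after an Euler step of length `h`, pulled back to the starting point. -/
noncomputable def pullbackDensity (p : ℝ × E d → ℝ) (w : ℝ × E d → E d) (z : ℝ × E d) (h : ℝ) : ℝ :=
  p (z + h • (1, w z)) * (1 + h • spatialDeriv w z).det

/-- The derivative of `pullbackDensity` in the step. -/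
noncomputable def pullbackDensityDeriv (p : ℝ × E d → ℝ) (w : ℝ × E d → E d) (z : ℝ × E d)
    (h : ℝ) : ℝ :=
  fderiv ℝ p (z + h • (1, w z)) (1, w z) * (1 + h • spatialDeriv w z).det +
    p (z + h • (1, w z)) * detDeriv (spatialDeriv w z) h

theorem hasDerivAt_pullbackDensity (hp : ContDiff ℝ 1 p) (z : ℝ × E d) (h : ℝ) :
    HasDerivAt (pullbackDensity p w z) (pullbackDensityDeriv p w z h) h := by
  have h1 : HasDerivAt (fun h : ℝ => z + h • ((1, w z) : ℝ × E d)) (1, w z) h := by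
    simpa using ((hasDerivAt_id h).smul_const ((1, w z) : ℝ × E d)).const_add z
  have h2 := (hp.differentiable one_ne_zero (z + h • (1, w z))).hasFDerivAt.comp_hasDerivAt h h1
  exact h2.mul (hasDerivAt_det_one_add (spatialDeriv w z) h)

theorem continuous_pullbackDensityDeriv (hp : ContDiff ℝ 1 p) (hw : ContDiff ℝ 1 w) :
    Continuous fun q : ℝ × (ℝ × E d) => pullbackDensityDeriv p w q.2 q.1 := by
  have h1 := hp.continuous_fderiv one_ne_zero
  have h2 := hp.continuous
  have h3 := hw.continuous
  have h4 := continuous_spatialDeriv hw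
  have h5 := (contDiff_det (d := d)).continuous
  have h6 : Continuous fun q : ℝ × (ℝ × E d) => q.2 + q.1 • ((1, w q.2) : ℝ × E d) := by fun_prop
  have h7 : Continuous fun q : ℝ × (ℝ × E d) => detDeriv (spatialDeriv w q.2) q.1 :=
    continuous_detDeriv.comp (by fun_prop : Continuous fun q : ℝ × (ℝ × E d) =>
      (spatialDeriv w q.2, q.1))
  have h8 : Continuous fun q : ℝ × (ℝ × E d) => (1 + q.1 • spatialDeriv w q.2).det :=
    h5.comp (by fun_prop)
  unfold pullbackDensityDeriv
  exact (((h1.comp h6).clm_apply (by fun_prop)).mul h8).add ((h2.comp h6).mul h7)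

theorem det_one_add_zero_smul (A : E d →L[ℝ] E d) : (1 + (0 : ℝ) • A).det = 1 := by
  have h : 1 + (0 : ℝ) • A = ContinuousLinearMap.id ℝ (E d) := by ext x; simp
  rw [h, ContinuousLinearMap.det]
  exact LinearMap.det_id

/-- At step zero the determinant is `1` and its derivative is the divergence, so this is the
continuity equation itself. -/
theorem SolvesContinuityEq.pullbackDensityDeriv_zero (hpw : SolvesContinuityEq p w)
    (z : ℝ × E d) : pullbackDensityDeriv p w z 0 = 0 := by
  have h := hpw.eq_zero z
  simp only [pullbackDensityDeriv, zero_smul, add_zero, detDeriv_zero]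
  rw [det_one_add_zero_smul, mul_one]
  exact h

/-- The derivative in the step vanishes at zero. By continuity and compactness it stays below `ε p`
for all small steps, uniformly over times in the unit interval and points of the ball; the mean
value inequality integrates this bound. -/
theorem SolvesContinuityEq.exists_step_le (hpw : SolvesContinuityEq p w) (R : ℝ) {ε : ℝ}
    (hε : 0 < ε) : ∃ δ > 0, ∀ h ∈ Icc (0 : ℝ) δ, ∀ τ ∈ Icc (0 : ℝ) 1,
      ∀ x ∈ Metric.closedBall (0 : E d) R,
        (1 - ε * h) * p (τ, x) ≤ pullbackDensity p w (τ, x) h := by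
  have hK : IsCompact (Icc (0 : ℝ) 1 ×ˢ Metric.closedBall (0 : E d) R) :=
    isCompact_Icc.prod (isCompact_closedBall _ _)
  have hc := continuous_pullbackDensityDeriv hpw.contDiff_density hpw.contDiff_field
  have hev : ∀ᶠ h in 𝓝 (0 : ℝ), ∀ z ∈ Icc (0 : ℝ) 1 ×ˢ Metric.closedBall (0 : E d) R,
      ‖pullbackDensityDeriv p w z h‖ < ε * p z := by
    refine hK.eventually_forall_of_forall_eventually fun z _ => ?_
    have hopen : IsOpen {q : ℝ × (ℝ × E d) | ‖pullbackDensityDeriv p w q.2 q.1‖ < ε * p q.2} :=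
      isOpen_lt hc.norm (continuous_const.mul (hpw.contDiff_density.continuous.comp continuous_snd))
    refine hopen.mem_nhds ?_
    change ‖pullbackDensityDeriv p w z 0‖ < ε * p z
    rw [hpw.pullbackDensityDeriv_zero, norm_zero]
    exact mul_pos hε (hpw.pos z)
  obtain ⟨δ, hδ, hball⟩ := Metric.eventually_nhds_iff_ball.1 hev
  refine ⟨δ / 2, by positivity, fun h hh τ hτ x hx => ?_⟩
  have hbd : ∀ r ∈ Icc (0 : ℝ) h, ‖pullbackDensityDeriv p w (τ, x) r‖ ≤ ε * p (τ, x) := by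
    intro r hr
    refine (hball r ?_ (τ, x) ⟨hτ, hx⟩).le
    rw [Metric.mem_ball, dist_zero_right, Real.norm_of_nonneg hr.1]
    linarith [hr.2, hh.2]
  have hmvt := (convex_Icc 0 h).norm_image_sub_le_of_norm_hasDerivWithin_le
    (fun r _ => (hasDerivAt_pullbackDensity hpw.contDiff_density (w := w) (τ, x) r).hasDerivWithinAt)
    hbd (left_mem_Icc.2 hh.1) (right_mem_Icc.2 hh.1)
  have h0 : pullbackDensity p w (τ, x) 0 = p (τ, x) := by
    rw [pullbackDensity, det_one_add_zero_smul, zero_smul, add_zero, mul_one]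
  rw [h0, sub_zero, Real.norm_of_nonneg hh.1, Real.norm_eq_abs] at hmvt
  have := (abs_le.1 hmvt).1
  linarith

/-- One Euler step almost transports the density. -/
theorem SolvesContinuityEq.exists_lintegral_step_le (hpw : SolvesContinuityEq p w) (R : ℝ) {ε : ℝ}
    (hε : 0 < ε) : ∃ δ > 0, ∀ h ∈ Icc (0 : ℝ) δ, ∀ τ ∈ Icc (0 : ℝ) 1, ∀ f : E d → ℝ≥0∞,
      ENNReal.ofReal (1 - ε * h) * ∫⁻ x in Metric.closedBall 0 R,
        f (x + h • w (τ, x)) * ENNReal.ofReal (p (τ, x)) ≤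
      ∫⁻ x, f x * ENNReal.ofReal (p (τ + h, x)) := by
  obtain ⟨δ, hδ, hstep⟩ := hpw.exists_step_le R hε
  obtain ⟨L, hL0, hL⟩ := exists_lipschitz_on_ball hpw.contDiff_field R
  -- The second bound gives `h * L < 1`. The Euler step is then injective on the ball, as the change
  -- of variables requires.
  refine ⟨min δ (1 / (L + 1)), by positivity, fun h hh τ hτ f => ?_⟩
  have hhδ : h ∈ Icc (0 : ℝ) δ := ⟨hh.1, hh.2.trans (min_le_left _ _)⟩
  have hhL : h * L < 1 := by
    have h1 := hh.2.trans (min_le_right _ _)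
    rw [le_div_iff₀ (by positivity)] at h1
    by_cases h0 : h = 0
    · simp [h0]
    · have : 0 < h := lt_of_le_of_ne hh.1 (Ne.symm h0)
      linarith
  set B := Metric.closedBall (0 : E d) R with hB
  set e : E d → E d := fun x => x + h • w (τ, x) with he
  have hinj : InjOn e B := by
    intro x hx y hy hxy
    have h1 : x - y = h • (w (τ, y) - w (τ, x)) := by
      simp only [he] at hxy
      rw [smul_sub, sub_eq_sub_iff_add_eq_add, add_comm (h • w (τ, y))]
      exact hxy
    have h2 : ‖x - y‖ ≤ h * L * ‖x - y‖ := by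
      calc ‖x - y‖ = h * ‖w (τ, y) - w (τ, x)‖ := by
            conv_lhs => rw [h1, norm_smul, Real.norm_of_nonneg hh.1]
        _ ≤ h * (L * ‖y - x‖) := by gcongr; exacts [hh.1, hL τ hτ y hy x hx]
        _ = h * L * ‖x - y‖ := by rw [norm_sub_rev]; ring
    by_contra hne
    have h3 : 0 < ‖x - y‖ := norm_pos_iff.2 (sub_ne_zero.2 hne)
    nlinarith
  have hder : ∀ x ∈ B, HasFDerivWithinAt e (1 + h • spatialDeriv w (τ, x)) B x := by
    intro x _
    exact ((hasFDerivAt_id x).fun_add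
      ((hasFDerivAt_spatial hpw.contDiff_field τ x).const_smul h)).hasFDerivWithinAt
  have hBm : MeasurableSet B := Metric.isClosed_closedBall.measurableSet
  have hcov := lintegral_image_eq_lintegral_abs_det_fderiv_mul volume hBm hder hinj
    fun x => f x * ENNReal.ofReal (p (τ + h, x))
  rw [← lintegral_const_mul' _ _ ENNReal.ofReal_ne_top]
  calc _ ≤ ∫⁻ x in B, ENNReal.ofReal |(1 + h • spatialDeriv w (τ, x)).det| *
        (f (e x) * ENNReal.ofReal (p (τ + h, e x))) := by
        refine setLIntegral_mono' hBm fun x hx => ?_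
        have h1 : ENNReal.ofReal (1 - ε * h) * ENNReal.ofReal (p (τ, x)) ≤
            ENNReal.ofReal |(1 + h • spatialDeriv w (τ, x)).det| *
              ENNReal.ofReal (p (τ + h, e x)) := by
          rw [← ENNReal.ofReal_mul' (hpw.pos _).le, ← ENNReal.ofReal_mul (abs_nonneg _)]
          refine ENNReal.ofReal_le_ofReal ((hstep h hhδ τ hτ x hx).trans ?_)
          have h2 : ((τ, x) : ℝ × E d) + h • (1, w (τ, x)) = (τ + h, e x) := by
            simp [he]
          rw [pullbackDensity, h2, mul_comm]
          exact mul_le_mul_of_nonneg_right (le_abs_self _) (hpw.pos _).le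
        calc _ = f (e x) * (ENNReal.ofReal (1 - ε * h) * ENNReal.ofReal (p (τ, x))) := by ring
          _ ≤ f (e x) * (ENNReal.ofReal |(1 + h • spatialDeriv w (τ, x)).det| *
              ENNReal.ofReal (p (τ + h, e x))) := by gcongr
          _ = _ := by ring
    _ = ∫⁻ x in e '' B, f x * ENNReal.ofReal (p (τ + h, x)) := hcov.symm
    _ ≤ _ := setLIntegral_le_lintegral _ _

/-- The starting points from which the first `k` Euler iterates stay in a ball. -/
def eulerStable (w : ℝ × E d → E d) (R h : ℝ) (k : ℕ) : Set (E d) :=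
  {x | ∀ i < k, eulerIter w h i x ∈ Metric.closedBall (0 : E d) R}

theorem isClosed_eulerStable (hw : Continuous w) (R h : ℝ) (k : ℕ) :
    IsClosed (eulerStable w R h k) := by
  have : eulerStable w R h k = ⋂ i, ⋂ (_ : i < k),
      eulerIter w h i ⁻¹' Metric.closedBall (0 : E d) R := by
    ext x; simp [eulerStable]
  rw [this]
  exact isClosed_iInter fun i => isClosed_iInter fun _ =>
    Metric.isClosed_closedBall.preimage (continuous_eulerIter hw h i)

/-- The one-step inequality is iterated, each step losing a factor `c`. It holds only inside the
ball, hence the restriction to starting points whose earlier iterates stay there. -/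
theorem lintegral_eulerIter_le (hw : Continuous w) {R h : ℝ} {c : ℝ≥0∞}
    (hstep : ∀ τ ∈ Icc (0 : ℝ) 1, ∀ f : E d → ℝ≥0∞,
      c * ∫⁻ x in Metric.closedBall 0 R, f (x + h • w (τ, x)) * ENNReal.ofReal (p (τ, x)) ≤
      ∫⁻ x, f x * ENNReal.ofReal (p (τ + h, x))) (h0 : 0 ≤ h) (k : ℕ) (hk : k * h ≤ 1)
    (f : E d → ℝ≥0∞) :
    c ^ k * ∫⁻ x in eulerStable w R h k, f (eulerIter w h k x) * ENNReal.ofReal (p (0, x)) ≤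
      ∫⁻ x, f x * ENNReal.ofReal (p (k * h, x)) := by
  induction k generalizing f with
  | zero =>
    simp only [pow_zero, one_mul, eulerIter, Nat.cast_zero, zero_mul]
    exact setLIntegral_le_lintegral _ _
  | succ k ih =>
    push_cast at hk ⊢
    have hk' : (k : ℝ) * h ≤ 1 := by linarith
    set B := Metric.closedBall (0 : E d) R with hB
    have hBm : MeasurableSet B := Metric.isClosed_closedBall.measurableSet
    have hS := fun k => (isClosed_eulerStable hw R h k).measurableSet
    -- The induction hypothesis is applied to the test function pulled back by the last step. The
    -- indicator records that the `k`-th iterate must still lie in the ball.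
    let g : E d → ℝ≥0∞ := B.indicator fun y => f (y + h • w (k * h, y))
    have hsucc : ∀ x, (eulerStable w R h (k + 1)).indicator
        (fun x => f (eulerIter w h (k + 1) x) * ENNReal.ofReal (p (0, x))) x =
        (eulerStable w R h k).indicator
          (fun x => g (eulerIter w h k x) * ENNReal.ofReal (p (0, x))) x := by
      intro x
      have hmem : x ∈ eulerStable w R h (k + 1) ↔
          x ∈ eulerStable w R h k ∧ eulerIter w h k x ∈ B := by
        constructor
        · intro hx
          exact ⟨fun i hi => hx i (by omega), hx k (by omega)⟩
        · rintro ⟨h1, h2⟩ i hi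
          rcases Nat.lt_succ_iff_lt_or_eq.1 hi with h3 | rfl
          · exact h1 i h3
          · exact h2
      by_cases h1 : x ∈ eulerStable w R h k
      · by_cases h2 : eulerIter w h k x ∈ B
        · rw [indicator_of_mem (hmem.2 ⟨h1, h2⟩), indicator_of_mem h1]
          simp only [g, indicator_of_mem h2]
          rfl
        · rw [indicator_of_notMem (fun h => h2 (hmem.1 h).2), indicator_of_mem h1]
          simp only [g, indicator_of_notMem h2, zero_mul]
      · rw [indicator_of_notMem (fun h => h1 (hmem.1 h).1), indicator_of_notMem h1]
    have hgint : ∫⁻ x, g x * ENNReal.ofReal (p (k * h, x)) =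
        ∫⁻ x in B, f (x + h • w (k * h, x)) * ENNReal.ofReal (p (k * h, x)) := by
      rw [← lintegral_indicator hBm]
      refine lintegral_congr fun x => ?_
      by_cases hx : x ∈ B
      · simp only [g, indicator_of_mem hx]
      · simp only [g, indicator_of_notMem hx, zero_mul]
    calc _ = c * (c ^ k * ∫⁻ x in eulerStable w R h k,
          g (eulerIter w h k x) * ENNReal.ofReal (p (0, x))) := by
          rw [← lintegral_indicator (hS (k + 1)), ← lintegral_indicator (hS k), pow_succ']
          simp_rw [hsucc]
          rw [mul_assoc]
      _ ≤ c * ∫⁻ x in B, f (x + h • w (k * h, x)) * ENNReal.ofReal (p (k * h, x)) := by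
          rw [← hgint]
          gcongr
          exact ih hk' g
      _ ≤ ∫⁻ x, f x * ENNReal.ofReal (p (k * h + h, x)) :=
          hstep _ ⟨by positivity, hk'⟩ f
      _ = _ := by rw [show (k : ℝ) * h + h = (k + 1) * h by ring]

/-- The Euler approximation of the transported indicator of `U`, restricted to the starting points
whose iterates stay in a ball. -/
noncomputable def eulerApprox (w : ℝ × E d → E d) (t R : ℝ) (U : Set (E d)) (n : ℕ) :
    E d → ℝ≥0∞ :=
  (eulerStable w R (t / n) n).indicator
    fun x => U.indicator (fun _ => 1) (eulerIter w (t / n) n x)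

theorem measurable_eulerApprox (hw : Continuous w) (t R : ℝ) {U : Set (E d)}
    (hU : MeasurableSet U) (n : ℕ) : Measurable (eulerApprox w t R U n) :=
  ((measurable_const.indicator hU).comp (continuous_eulerIter hw _ _).measurable).indicator
    (isClosed_eulerStable hw _ _ _).measurableSet

/-- The measure with density `p (t, ·)`. -/
noncomputable def densityMeasure (p : ℝ × E d → ℝ) (t : ℝ) : Measure (E d) :=
  volume.withDensity fun x => ENNReal.ofReal (p (t, x))

theorem lintegral_densityMeasure (hp : Continuous p) (t : ℝ) {f : E d → ℝ≥0∞}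
    (hf : Measurable f) :
    ∫⁻ x, f x ∂(densityMeasure p t) = ∫⁻ x, f x * ENNReal.ofReal (p (t, x)) := by
  rw [densityMeasure, lintegral_withDensity_eq_lintegral_mul _ (by fun_prop) hf]
  exact lintegral_congr fun x => by rw [Pi.mul_apply, mul_comm]

/-- With `n` steps of length `t / n` the accumulated loss `(1 - ε t / n) ^ n` is at least `1 - ε`
for large `n`, and `ε` is arbitrary. -/
theorem SolvesContinuityEq.liminf_lintegral_eulerApprox_le (hpw : SolvesContinuityEq p w) {t : ℝ}
    (ht : t ∈ Icc (0 : ℝ) 1) (R : ℝ) {U : Set (E d)} (hU : MeasurableSet U) :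
    liminf (fun n => ∫⁻ x, eulerApprox w t R U n x ∂(densityMeasure p 0)) atTop ≤
      densityMeasure p t U := by
  have hw := hpw.contDiff_field.continuous
  have hp := hpw.contDiff_density.continuous
  set l := liminf (fun n => ∫⁻ x, eulerApprox w t R U n x ∂(densityMeasure p 0)) atTop
  have hε : ∀ ε : ℝ, 0 < ε → ε < 1 → ENNReal.ofReal (1 - ε) * l ≤ densityMeasure p t U := by
    intro ε hε hε1
    obtain ⟨δ, hδ, hstep⟩ := hpw.exists_lintegral_step_le R hε
    obtain ⟨n₀, hn₀⟩ := exists_nat_ge (1 / δ)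
    have hev : ∀ᶠ n : ℕ in atTop, ENNReal.ofReal (1 - ε) *
        ∫⁻ x, eulerApprox w t R U n x ∂(densityMeasure p 0) ≤ densityMeasure p t U := by
      filter_upwards [eventually_ge_atTop (n₀ + 1)] with n hn
      have hnpos : (0 : ℝ) < n := by
        have : 0 < n := by omega
        exact_mod_cast this
      have hnh : n * (t / n) = t := by field_simp
      have h0 : 0 ≤ t / n := div_nonneg ht.1 hnpos.le
      have hhδ : t / n ≤ δ := by
        have h1 : (n₀ : ℝ) ≤ n := by
          have : n₀ ≤ n := by omega
          exact_mod_cast this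
        rw [div_le_iff₀ hnpos]
        have : 1 ≤ n₀ * δ := by rwa [div_le_iff₀ hδ] at hn₀
        nlinarith [ht.2]
      have hiter := lintegral_eulerIter_le hw (R := R) (hstep (t / n) ⟨h0, hhδ⟩) h0 n
        (by rw [hnh]; exact ht.2) (U.indicator fun _ => 1)
      rw [hnh] at hiter
      have hR : densityMeasure p t U =
          ∫⁻ x, U.indicator (fun _ => 1) x * ENNReal.ofReal (p (t, x)) := by
        rw [← lintegral_densityMeasure hp t (measurable_const.indicator hU),
          lintegral_indicator_const hU, one_mul]
      have hLft : ∫⁻ x, eulerApprox w t R U n x ∂(densityMeasure p 0) =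
          ∫⁻ x in eulerStable w R (t / n) n, U.indicator (fun _ => 1) (eulerIter w (t / n) n x) *
            ENNReal.ofReal (p (0, x)) := by
        rw [lintegral_densityMeasure hp 0 (measurable_eulerApprox hw t R hU n),
          ← lintegral_indicator (isClosed_eulerStable hw _ _ _).measurableSet]
        refine lintegral_congr fun x => ?_
        by_cases hx : x ∈ eulerStable w R (t / n) n
        · simp only [eulerApprox, indicator_of_mem hx]
        · simp only [eulerApprox, indicator_of_notMem hx, zero_mul]
      rw [hLft, hR]
      refine le_trans ?_ hiter
      gcongr
      have h2 : 0 ≤ 1 - ε * (t / n) := by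
        have : t / n ≤ 1 := by
          rw [div_le_one hnpos]
          have : (1 : ℝ) ≤ n := by
            have : 1 ≤ n := by omega
            exact_mod_cast this
          linarith [ht.2]
        nlinarith
      rw [← ENNReal.ofReal_pow h2]
      refine ENNReal.ofReal_le_ofReal ?_
      -- Bernoulli's inequality bounds the accumulated loss below by `1 - ε t`.
      have hb := one_add_mul_le_pow (a := -(ε * (t / n))) (by linarith) n
      have h3 : (n : ℝ) * -(ε * (t / n)) = -(ε * t) := by
        rw [← hnh]; field_simp
      rw [h3] at hb
      calc 1 - ε ≤ 1 + -(ε * t) := by nlinarith [ht.2]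
        _ ≤ _ := hb
        _ = _ := by ring
    calc ENNReal.ofReal (1 - ε) * l =
        liminf (fun n => ENNReal.ofReal (1 - ε) *
          ∫⁻ x, eulerApprox w t R U n x ∂(densityMeasure p 0)) atTop :=
          (ENNReal.liminf_const_mul_of_ne_top ENNReal.ofReal_ne_top).symm
      _ ≤ densityMeasure p t U := liminf_le_of_frequently_le' hev.frequently
  have hlim : Tendsto (fun ε : ℝ => ENNReal.ofReal (1 - ε) * l) (𝓝[>] 0) (𝓝 (1 * l)) := by
    refine ENNReal.Tendsto.mul_const ?_ (Or.inl one_ne_zero)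
    have : Continuous fun ε : ℝ => ENNReal.ofReal (1 - ε) :=
      ENNReal.continuous_ofReal.comp (by fun_prop)
    simpa using (this.tendsto 0).mono_left nhdsWithin_le_nhds
  rw [one_mul] at hlim
  refine le_of_tendsto hlim ?_
  filter_upwards [Ioo_mem_nhdsGT (zero_lt_one' ℝ)] with ε h using hε ε h.1 h.2

variable {α : Type*} [MeasurableSpace α] {μ : Measure α} {X : ℝ → α → E d}

theorem SolvesContinuityEq.ae_exists_bound (hpw : SolvesContinuityEq p w)
    (hX : ∀ᵐ a ∂μ, ∀ τ ∈ Icc (0 : ℝ) 1,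
      HasDerivWithinAt (fun τ => X τ a) (w (τ, X τ a)) (Icc 0 1) τ) {t : ℝ}
    (ht : t ∈ Icc (0 : ℝ) 1) :
    ∀ᵐ a ∂μ, ∃ R : ℝ, ∀ ε > 0, ∀ᶠ n : ℕ in atTop,
      (∀ k ≤ n, ‖eulerIter w (t / n) k (X 0 a)‖ ≤ R) ∧
        ‖eulerIter w (t / n) n (X 0 a) - X t a‖ ≤ ε := by
  filter_upwards [hX] with a ha
  exact eventually_eulerIter_near hpw.contDiff_field.continuous
    (exists_lipschitz_on_ball hpw.contDiff_field) ha ht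

/-- No measurability of the flow at positive times is assumed: it is an almost everywhere limit of
Euler iterates, which are continuous functions of the starting point. -/
theorem SolvesContinuityEq.aemeasurable_of_ae_hasDerivWithinAt (hpw : SolvesContinuityEq p w)
    (hX0 : AEMeasurable (X 0) μ)
    (hX : ∀ᵐ a ∂μ, ∀ τ ∈ Icc (0 : ℝ) 1,
      HasDerivWithinAt (fun τ => X τ a) (w (τ, X τ a)) (Icc 0 1) τ) {t : ℝ}
    (ht : t ∈ Icc (0 : ℝ) 1) : AEMeasurable (X t) μ := by
  refine aemeasurable_of_tendsto_metrizable_ae (atTop : Filter ℕ)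
    (f := fun (n : ℕ) a => eulerIter w (t / n) n (X 0 a))
    (fun n => (continuous_eulerIter hpw.contDiff_field.continuous _ _).measurable.comp_aemeasurable
      hX0) ?_
  filter_upwards [hpw.ae_exists_bound hX ht] with a ha
  obtain ⟨R, hR⟩ := ha
  rw [Metric.tendsto_nhds]
  intro ε hε
  filter_upwards [hR (ε / 2) (by positivity)] with n hn
  rw [dist_eq_norm]
  linarith [hn.2]

/-- **Transport along characteristics**: if almost every trajectory of the field exists on the unit
time interval, the trajectories carry the initial density to the density at time `t`. -/
theorem SolvesContinuityEq.map_eq (hpw : SolvesContinuityEq p w)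
    (hprob : ∀ t, IsProbabilityMeasure (densityMeasure p t)) (hX0 : AEMeasurable (X 0) μ)
    (hμ : μ.map (X 0) = densityMeasure p 0)
    (hX : ∀ᵐ a ∂μ, ∀ τ ∈ Icc (0 : ℝ) 1,
      HasDerivWithinAt (fun τ => X τ a) (w (τ, X τ a)) (Icc 0 1) τ) {t : ℝ}
    (ht : t ∈ Icc (0 : ℝ) 1) : μ.map (X t) = densityMeasure p t := by
  have hw := hpw.contDiff_field.continuous
  have hXt := hpw.aemeasurable_of_ae_hasDerivWithinAt hX0 hX ht
  have hprobμ : IsProbabilityMeasure μ := by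
    refine ⟨?_⟩
    have h1 := congrArg (fun m => m univ) hμ
    simpa [Measure.map_apply_of_aemeasurable hX0 MeasurableSet.univ] using h1
  have := hprob t
  have hopen : ∀ U : Set (E d), IsOpen U → μ.map (X t) U ≤ densityMeasure p t U := by
    intro U hU
    have hUm := hU.measurableSet
    let F : ℕ → ℕ → α → ℝ≥0∞ := fun R n a => eulerApprox w t R U n (X 0 a)
    have hFm : ∀ R n, AEMeasurable (F R n) μ := fun R n =>
      (measurable_eulerApprox hw t R hUm n).comp_aemeasurable hX0
    -- Since `U` is open, the iterates of a trajectory ending in `U` eventually end in `U` too. The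
    -- radius confining them depends on the trajectory, hence the outer limit in `R`; Fatou is used
    -- once for each limit.
    have hpt : ∀ᵐ a ∂μ, U.indicator (fun _ => (1 : ℝ≥0∞)) (X t a) ≤
        liminf (fun R : ℕ => liminf (fun n => F R n a) atTop) atTop := by
      filter_upwards [hpw.ae_exists_bound hX ht] with a ha
      obtain ⟨R₀, hR₀⟩ := ha
      by_cases hmem : X t a ∈ U
      · rw [indicator_of_mem hmem]
        obtain ⟨ε, hε, hball⟩ := Metric.isOpen_iff.1 hU _ hmem
        obtain ⟨R₁, hR₁⟩ := exists_nat_ge R₀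
        refine le_liminf_of_le (by isBoundedDefault) ?_
        filter_upwards [eventually_ge_atTop R₁] with R hR
        refine le_liminf_of_le (by isBoundedDefault) ?_
        filter_upwards [hR₀ (ε / 2) (by positivity)] with n hn
        have hRR : R₀ ≤ R := hR₁.trans (by exact_mod_cast hR)
        have hst : X 0 a ∈ eulerStable w R (t / n) n := fun i hi => by
          rw [mem_closedBall_zero_iff]
          exact (hn.1 i hi.le).trans hRR
        have hin : eulerIter w (t / n) n (X 0 a) ∈ U := by
          apply hball
          rw [Metric.mem_ball, dist_eq_norm]
          linarith [hn.2]
        simp only [F, eulerApprox, indicator_of_mem hst, indicator_of_mem hin, le_refl]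
      · rw [indicator_of_notMem hmem]
        exact bot_le
    have hinner : ∀ R : ℕ, ∫⁻ a, liminf (fun n => F R n a) atTop ∂μ ≤ densityMeasure p t U := by
      intro R
      refine (lintegral_liminf_le' (hFm R)).trans ?_
      have hFint : ∀ n, ∫⁻ a, F R n a ∂μ =
          ∫⁻ x, eulerApprox w t R U n x ∂(densityMeasure p 0) := fun n => by
        rw [← hμ, lintegral_map' (measurable_eulerApprox hw t R hUm n).aemeasurable hX0]
      simp_rw [hFint]
      exact hpw.liminf_lintegral_eulerApprox_le ht R hUm
    calc μ.map (X t) U = ∫⁻ a, U.indicator (fun _ => (1 : ℝ≥0∞)) (X t a) ∂μ := by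
          rw [← lintegral_map' (measurable_const.indicator hUm).aemeasurable hXt,
            lintegral_indicator_const hUm, one_mul]
      _ ≤ ∫⁻ a, liminf (fun R : ℕ => liminf (fun n => F R n a) atTop) atTop ∂μ :=
          lintegral_mono_ae hpt
      _ ≤ liminf (fun R : ℕ => ∫⁻ a, liminf (fun n => F R n a) atTop ∂μ) atTop :=
          lintegral_liminf_le' fun R => (Measurable.liminf fun n =>
            measurable_eulerApprox hw t R hUm n).comp_aemeasurable hX0
      _ ≤ densityMeasure p t U :=
          liminf_le_of_frequently_le' (Eventually.of_forall hinner).frequently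
  have hprobm : IsProbabilityMeasure (μ.map (X t)) := Measure.isProbabilityMeasure_map hXt
  -- Outer regularity extends the inequality from open sets to all sets, and two probability
  -- measures so ordered are equal.
  refine Measure.eq_of_le_of_measure_univ_eq (Measure.le_intro fun s _ _ => ?_) (by simp)
  rw [s.measure_eq_iInf_isOpen (densityMeasure p t)]
  exact le_iInf fun U => le_iInf fun hsU => le_iInf fun hU => (measure_mono hsU).trans (hopen U hU)

end Transport

/-! ### Mixtures of translating profiles solve the continuity equation -/

section MovingMixture

variable {d : ℕ} {Z : Type*} [MeasurableSpace Z] {F : Type*} [NormedAddCommGroup F]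
  [NormedSpace ℝ F]

/-- The derivative of `(t, x) ↦ x - t k`. -/
noncomputable def shear (k : E d) : ℝ × E d →L[ℝ] E d :=
  ContinuousLinearMap.snd ℝ ℝ (E d) - (ContinuousLinearMap.fst ℝ ℝ (E d)).smulRight k

theorem shear_apply (k : E d) (z : ℝ × E d) : shear k z = z.2 - z.1 • k := rfl

theorem norm_shear_le (k : E d) : ‖shear k‖ ≤ 1 + ‖k‖ := by
  refine ContinuousLinearMap.opNorm_le_bound _ (by positivity) fun z => ?_
  rw [shear_apply]
  have h1 := norm_snd_le z
  have h2 := norm_fst_le z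
  calc ‖z.2 - z.1 • k‖ ≤ ‖z.2‖ + ‖z.1‖ * ‖k‖ := by
        rw [← norm_smul]; exact norm_sub_le _ _
    _ ≤ ‖z‖ + ‖z‖ * ‖k‖ := by gcongr
    _ = _ := by ring

theorem continuous_shear : Continuous (shear (d := d)) := by
  unfold shear
  exact continuous_const.sub
    ((ContinuousLinearMap.smulRightL ℝ (ℝ × E d) (E d) (ContinuousLinearMap.fst ℝ ℝ (E d))).continuous)

/-- The derivative in `(t, x)` of `g (x - m - t k) • c`. -/
noncomputable def shearDeriv (g : E d → ℝ) (m k : E d) (c : F) (z : ℝ × E d) : ℝ × E d →L[ℝ] F :=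
  ((fderiv ℝ g (shear k z - m)).comp (shear k)).smulRight c

theorem hasFDerivAt_shear {g : E d → ℝ} (hg : ContDiff ℝ 1 g) (m k : E d) (c : F) (z : ℝ × E d) :
    HasFDerivAt (fun z => g (shear k z - m) • c) (shearDeriv g m k c z) z := by
  have h1 : HasFDerivAt (fun z => shear k z - m) (shear k) z :=
    (shear k).hasFDerivAt.sub_const m
  exact ((hg.differentiable one_ne_zero _).hasFDerivAt.comp z h1).smul_const c

theorem norm_shearDeriv_le {g : E d → ℝ} {C : ℝ} (hC : ∀ x, ‖fderiv ℝ g x‖ ≤ C) (m k : E d)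
    (c : F) (z : ℝ × E d) : ‖shearDeriv g m k c z‖ ≤ C * ((1 + ‖k‖) * ‖c‖) := by
  have hC0 : 0 ≤ C := (norm_nonneg _).trans (hC 0)
  rw [shearDeriv, ContinuousLinearMap.norm_smulRight_apply, ← mul_assoc]
  gcongr
  exact (ContinuousLinearMap.opNorm_comp_le _ _).trans
    (mul_le_mul (hC _) (norm_shear_le k) (norm_nonneg _) hC0)

theorem continuous_shearDeriv {g : E d → ℝ} (hg : ContDiff ℝ 1 g) :
    Continuous fun q : (E d × E d × F) × (ℝ × E d) =>
      shearDeriv g q.1.1 q.1.2.1 q.1.2.2 q.2 := by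
  have h1 := hg.continuous_fderiv one_ne_zero
  have h2 : Continuous fun q : (E d × E d × F) × (ℝ × E d) => shear q.1.2.1 :=
    continuous_shear.comp (by fun_prop)
  have h3 : Continuous fun q : (E d × E d × F) × (ℝ × E d) =>
      (fderiv ℝ g (shear q.1.2.1 q.2 - q.1.1)).comp (shear q.1.2.1) :=
    (h1.comp ((h2.clm_apply continuous_snd).sub (by fun_prop))).clm_comp h2
  have h4 := (ContinuousLinearMap.smulRightL ℝ (ℝ × E d) F).isBoundedBilinearMap.continuous
  exact h4.comp (h3.prodMk (by fun_prop : Continuous fun q : (E d × E d × F) × (ℝ × E d) => q.1.2.2))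

/-- The superposition of the profiles `g` centred at `m + t k`, with weights `c`. -/
noncomputable def movingMixture (q : Measure Z) (g : E d → ℝ) (m k : Z → E d) (c : Z → F)
    (z : ℝ × E d) : F :=
  ∫ a, g (shear (k a) z - m a) • c a ∂q

variable {q : Measure Z} {g : E d → ℝ} {m k : Z → E d} {c : Z → F}

theorem integrable_movingMixture (hg : ContDiff ℝ 1 g) {B : ℝ} (hB : ∀ x, ‖g x‖ ≤ B)
    (hm : Measurable m) (hk : Measurable k) (hc : Integrable c q) (z : ℝ × E d) :
    Integrable (fun a => g (shear (k a) z - m a) • c a) q := by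
  have h1 : Measurable fun a => g (shear (k a) z - m a) := by
    simp only [shear_apply]
    exact hg.continuous.measurable.comp (by fun_prop)
  exact hc.bdd_smul B h1.aestronglyMeasurable (Eventually.of_forall fun a => hB _)

variable [SecondCountableTopology F] [MeasurableSpace F] [BorelSpace F]

theorem aestronglyMeasurable_shearDeriv (hg : ContDiff ℝ 1 g) (hm : Measurable m)
    (hk : Measurable k) (hc : Measurable c) (z : ℝ × E d) :
    AEStronglyMeasurable (fun a => shearDeriv g (m a) (k a) (c a) z) q := by
  have h1 : AEStronglyMeasurable (fun a => ((m a, k a, c a), z)) q :=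
    (hm.aestronglyMeasurable.prodMk
      (hk.aestronglyMeasurable.prodMk hc.aestronglyMeasurable)).prodMk aestronglyMeasurable_const
  have h2 := (continuous_shearDeriv (F := F) hg).comp_aestronglyMeasurable h1
  exact h2

theorem integrable_shearDeriv (hg : ContDiff ℝ 1 g) {C : ℝ} (hC : ∀ x, ‖fderiv ℝ g x‖ ≤ C)
    (hm : Measurable m) (hk : Measurable k) (hc : Measurable c)
    (hint : Integrable (fun a => (1 + ‖k a‖) * ‖c a‖) q) (z : ℝ × E d) :
    Integrable (fun a => shearDeriv g (m a) (k a) (c a) z) q :=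
  (hint.const_mul C).mono' (aestronglyMeasurable_shearDeriv hg hm hk hc z)
    (Eventually.of_forall fun _ => norm_shearDeriv_le hC _ _ _ _)

/-- The derivative of the integrand is dominated, uniformly in `z`, by a multiple of `(1 + ‖k‖) *
‖c‖`. With `c = k` this calls for a second moment of the velocity. -/
theorem hasFDerivAt_movingMixture (hg : ContDiff ℝ 1 g) {B C : ℝ} (hB : ∀ x, ‖g x‖ ≤ B)
    (hC : ∀ x, ‖fderiv ℝ g x‖ ≤ C) (hm : Measurable m) (hk : Measurable k) (hc : Measurable c)
    (hci : Integrable c q) (hint : Integrable (fun a => (1 + ‖k a‖) * ‖c a‖) q) (z : ℝ × E d) :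
    HasFDerivAt (movingMixture q g m k c) (∫ a, shearDeriv g (m a) (k a) (c a) z ∂q) z :=
  hasFDerivAt_integral_of_dominated_of_fderiv_le (s := univ) univ_mem
    (Eventually.of_forall fun z => (integrable_movingMixture hg hB hm hk hci z).1)
    (integrable_movingMixture hg hB hm hk hci z)
    (aestronglyMeasurable_shearDeriv hg hm hk hc z)
    (Eventually.of_forall fun _ _ _ => norm_shearDeriv_le hC _ _ _ _) (hint.const_mul C)
    (Eventually.of_forall fun _ _ _ => hasFDerivAt_shear hg _ _ _ _)

theorem contDiff_movingMixture (hg : ContDiff ℝ 1 g) {B C : ℝ} (hB : ∀ x, ‖g x‖ ≤ B)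
    (hC : ∀ x, ‖fderiv ℝ g x‖ ≤ C) (hm : Measurable m) (hk : Measurable k) (hc : Measurable c)
    (hci : Integrable c q) (hint : Integrable (fun a => (1 + ‖k a‖) * ‖c a‖) q) :
    ContDiff ℝ 1 (movingMixture q g m k c) := by
  refine contDiff_one_iff_hasFDerivAt.2 ⟨fun z => ∫ a, shearDeriv g (m a) (k a) (c a) z ∂q, ?_,
    hasFDerivAt_movingMixture hg hB hC hm hk hc hci hint⟩
  refine continuous_of_dominated (fun z => aestronglyMeasurable_shearDeriv hg hm hk hc z)
    (fun z => Eventually.of_forall fun _ => norm_shearDeriv_le hC _ _ _ _) (hint.const_mul C)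
    (Eventually.of_forall fun a => ?_)
  have h1 : Continuous fun z : ℝ × E d => ((m a, k a, c a), z) := by fun_prop
  have h2 := (continuous_shearDeriv (F := F) hg).comp h1
  exact h2

/-- The density of a mixture of moving profiles. -/
noncomputable def mixtureDensity (q : Measure Z) (g : E d → ℝ) (m k : Z → E d) (z : ℝ × E d) : ℝ :=
  movingMixture q g m k (fun _ => (1 : ℝ)) z

/-- The mean velocity of a mixture of moving profiles. -/
noncomputable def mixtureField (q : Measure Z) (g : E d → ℝ) (m k : Z → E d) (z : ℝ × E d) : E d :=
  (mixtureDensity q g m k z)⁻¹ • movingMixture q g m k k z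

/-- With `P` the density and `N` the momentum, `P` times the field is `N`. A profile moving with
velocity `k` has time derivative `-Dg(k)`, and `Dg(k)` is the divergence of `g k`. Integrating gives
`∂ₜ P = - div N`, and the product rule for `N` rewrites this as the continuity equation. -/
theorem solvesContinuityEq_mixture [IsProbabilityMeasure q] (hg : ContDiff ℝ 1 g) {B C : ℝ}
    (hB : ∀ x, ‖g x‖ ≤ B) (hC : ∀ x, ‖fderiv ℝ g x‖ ≤ C) (hpos : ∀ x, 0 < g x)
    (hm : Measurable m) (hk : Measurable k) (hk2 : MemLp k 2 q) :
    SolvesContinuityEq (mixtureDensity q g m k) (mixtureField q g m k) := by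
  have hki : Integrable k q := hk2.integrable one_le_two
  have hi1 : Integrable (fun _ : Z => (1 : ℝ)) q := integrable_const _
  have hb1 : Integrable (fun a => (1 + ‖k a‖) * ‖(1 : ℝ)‖) q := by
    simpa using hi1.add hki.norm
  have hb2 : Integrable (fun a => (1 + ‖k a‖) * ‖k a‖) q := by
    have h1 : Integrable (fun a => ‖k a‖ ^ 2) q := hk2.integrable_norm_pow two_ne_zero
    refine (hki.norm.add h1).congr (Eventually.of_forall fun a => ?_)
    simp only [Pi.add_apply]
    ring
  have hP := contDiff_movingMixture (m := m) (q := q) hg hB hC hm hk measurable_const hi1 hb1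
  have hN := contDiff_movingMixture (m := m) (q := q) hg hB hC hm hk hk hki hb2
  have hPd := hasFDerivAt_movingMixture (m := m) (q := q) hg hB hC hm hk measurable_const hi1 hb1
  have hNd := hasFDerivAt_movingMixture (m := m) (q := q) hg hB hC hm hk hk hki hb2
  have hPi := integrable_shearDeriv (m := m) (q := q) hg hC hm hk measurable_const hb1
  have hNi := integrable_shearDeriv (m := m) (q := q) hg hC hm hk hk hb2
  have hP0 : ∀ z, 0 < mixtureDensity q g m k z := by
    intro z
    have hi := integrable_movingMixture (m := m) hg hB hm hk hi1 z
    rw [mixtureDensity, movingMixture, integral_pos_iff_support_of_nonneg _ hi]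
    · have : Function.support (fun a => g (shear (k a) z - m a) • (1 : ℝ)) = univ := by
        ext a; simp [(hpos _).ne']
      rw [this]; simp
    · exact fun a => by simpa using (hpos _).le
  have hW : ContDiff ℝ 1 (mixtureField q g m k) :=
    (hP.inv fun z => (hP0 z).ne').smul hN
  refine ⟨hP0, hP, hW, fun z => ?_⟩
  set P := mixtureDensity q g m k with hPdef
  set N := movingMixture q g m k k with hNdef
  have hNeq : N = fun z => P z • mixtureField q g m k z := by
    funext z
    rw [mixtureField, smul_smul, mul_inv_cancel₀ (hP0 z).ne', one_smul]
  -- the product rule for `N = P • w`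
  have hprod : fderiv ℝ N z = P z • fderiv ℝ (mixtureField q g m k) z +
      (fderiv ℝ P z).smulRight (mixtureField q g m k z) := by
    rw [hNeq]
    exact fderiv_fun_smul (hP.differentiable one_ne_zero z) (hW.differentiable one_ne_zero z)
  let τ : (E d →L[ℝ] E d) →L[ℝ] ℝ := LinearMap.toContinuousLinearMap
    ((LinearMap.trace ℝ (E d)).comp (ContinuousLinearMap.coeLM ℝ))
  have hτ : ∀ A : E d →L[ℝ] E d, τ A = LinearMap.trace ℝ (E d) A := fun A => rfl
  -- The spatial divergence is packaged as a bounded linear functional of the full derivative, so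
  -- that it commutes with the Bochner integral.
  let ρ : (ℝ × E d →L[ℝ] E d) →L[ℝ] ℝ := τ.comp
    ((ContinuousLinearMap.compL ℝ (E d) (ℝ × E d) (E d)).flip (ContinuousLinearMap.inr ℝ ℝ (E d)))
  have hρ : ∀ A : ℝ × E d →L[ℝ] E d,
      ρ A = LinearMap.trace ℝ (E d) (A.comp (ContinuousLinearMap.inr ℝ ℝ (E d))) := fun A => rfl
  have hρsmul : ∀ (φ : ℝ × E d →L[ℝ] ℝ) (v : E d), ρ (φ.smulRight v) = φ (0, v) := by
    intro φ v
    rw [hρ]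
    exact LinearMap.trace_smulRight
      ((φ.comp (ContinuousLinearMap.inr ℝ ℝ (E d)) : E d →L[ℝ] ℝ) : E d →ₗ[ℝ] ℝ) v
  have hdivN : ρ (fderiv ℝ N z) = ∫ a, fderiv ℝ g (shear (k a) z - m a) (k a) ∂q := by
    rw [(hNd z).fderiv, ← ρ.integral_comp_comm (hNi z)]
    refine integral_congr_ae (Eventually.of_forall fun a => ?_)
    change ρ (((fderiv ℝ g (shear (k a) z - m a)).comp (shear (k a))).smulRight (k a)) = _
    have h2 : shear (k a) ((0, k a) : ℝ × E d) = k a := by simp [shear_apply]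
    rw [hρsmul, ContinuousLinearMap.comp_apply, h2]
  have hdtP : fderiv ℝ P z (1, 0) = -∫ a, fderiv ℝ g (shear (k a) z - m a) (k a) ∂q := by
    have h1 : fderiv ℝ P z = ∫ a, shearDeriv g (m a) (k a) (1 : ℝ) z ∂q := (hPd z).fderiv
    rw [h1, ContinuousLinearMap.integral_apply (hPi z), ← integral_neg]
    refine integral_congr_ae (Eventually.of_forall fun a => ?_)
    change fderiv ℝ g (shear (k a) z - m a) (shear (k a) (1, 0)) • (1 : ℝ) = _
    have h2 : shear (k a) ((1, 0) : ℝ × E d) = -k a := by simp [shear_apply]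
    rw [h2, map_neg, smul_eq_mul, mul_one]
  have hsplit : fderiv ℝ P z (1, mixtureField q g m k z) =
      fderiv ℝ P z (1, 0) + fderiv ℝ P z (0, mixtureField q g m k z) := by
    rw [← map_add]; simp
  have hfin := congrArg ρ hprod
  rw [map_add, map_smul, hρsmul, hdivN, hρ] at hfin
  rw [hsplit, hdtP, hfin, spatialDeriv, smul_eq_mul]
  ring

end MovingMixture

/-! ### The Gaussian as a profile -/

section GaussianProfile

variable {d : ℕ}

theorem contDiff_gaussDensity (σ : ℝ) : ContDiff ℝ 1 (gaussDensity σ (0 : E d)) := by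
  unfold gaussDensity
  simp only [sub_zero]
  exact contDiff_const.mul (Real.contDiff_exp.comp ((contDiff_norm_sq ℝ).neg.div_const _))

/-- With `u = ‖x‖ ^ 2 / (2 σ ^ 2)` the linear factor of the gradient is at most a multiple of `1 +
u`, by `‖x‖ ≤ 1 + ‖x‖ ^ 2`, and `exp (-u) * (1 + u) ≤ 1`. -/
theorem exists_bound_fderiv_gaussDensity {σ : ℝ} (hσ : 0 < σ) :
    ∃ C, ∀ x : E d, ‖fderiv ℝ (gaussDensity σ (0 : E d)) x‖ ≤ C := by
  set A := (Real.sqrt (2 * Real.pi * σ ^ 2) ^ d)⁻¹ with hA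
  have hA0 : 0 ≤ A := by positivity
  refine ⟨A * (1 / σ ^ 2 + 2), fun x => ?_⟩
  have hd : HasFDerivAt (gaussDensity σ (0 : E d))
      (A • (Real.exp (-‖x‖ ^ 2 / (2 * σ ^ 2)) • ((-(1 / (2 * σ ^ 2))) • (2 • innerSL ℝ x)))) x := by
    have h1 : HasFDerivAt (fun x : E d => ‖x‖ ^ 2) (2 • innerSL ℝ x) x :=
      (hasStrictFDerivAt_norm_sq x).hasFDerivAt
    have h2 := ((h1.const_mul (-(1 / (2 * σ ^ 2)))).exp).const_mul A
    convert! h2 using 1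
    · funext y
      simp only [gaussDensity, sub_zero, hA]
      congr 2
      ring
    · congr 3
      ring
  rw [hd.fderiv, norm_smul, norm_smul, norm_smul, Real.norm_of_nonneg hA0, Real.norm_eq_abs,
    Real.norm_eq_abs, Real.abs_exp, abs_neg, abs_of_pos (by positivity : 0 < 1 / (2 * σ ^ 2))]
  gcongr
  have hn : ‖2 • innerSL ℝ x‖ ≤ 2 * ‖x‖ := by
    refine (norm_nsmul_le).trans ?_
    rw [innerSL_apply_norm]
    simp
  set u := ‖x‖ ^ 2 / (2 * σ ^ 2) with hu
  have hu0 : 0 ≤ u := by positivity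
  have he : Real.exp (-‖x‖ ^ 2 / (2 * σ ^ 2)) * (1 + u) ≤ 1 := by
    have h1 : -‖x‖ ^ 2 / (2 * σ ^ 2) = -u := by rw [hu, neg_div]
    rw [h1, Real.exp_neg, inv_mul_le_iff₀ (Real.exp_pos _), mul_one]
    linarith [Real.add_one_le_exp u]
  have hx : 1 / (2 * σ ^ 2) * (2 * ‖x‖) ≤ (1 / σ ^ 2 + 2) * (1 + u) := by
    have h2 : ‖x‖ ≤ 1 + ‖x‖ ^ 2 := by nlinarith [sq_nonneg (‖x‖ - 1), norm_nonneg x]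
    have h3 : 1 / (2 * σ ^ 2) * (2 * ‖x‖) = 1 / σ ^ 2 * ‖x‖ := by field_simp
    have h4 : 1 / σ ^ 2 * ‖x‖ ^ 2 = 2 * u := by rw [hu]; field_simp
    have h5 : 0 ≤ 1 / σ ^ 2 := by positivity
    rw [h3]
    calc 1 / σ ^ 2 * ‖x‖ ≤ 1 / σ ^ 2 * (1 + ‖x‖ ^ 2) := by gcongr
      _ = 1 / σ ^ 2 + 2 * u := by rw [mul_add, h4, mul_one]
      _ ≤ _ := by nlinarith [mul_nonneg h5 hu0]
  calc Real.exp (-‖x‖ ^ 2 / (2 * σ ^ 2)) * (1 / (2 * σ ^ 2) * ‖2 • innerSL ℝ x‖)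
      ≤ Real.exp (-‖x‖ ^ 2 / (2 * σ ^ 2)) * ((1 / σ ^ 2 + 2) * (1 + u)) := by
        refine mul_le_mul_of_nonneg_left ?_ (Real.exp_nonneg _)
        exact (mul_le_mul_of_nonneg_left hn (by positivity)).trans hx
    _ = (1 / σ ^ 2 + 2) * (Real.exp (-‖x‖ ^ 2 / (2 * σ ^ 2)) * (1 + u)) := by ring
    _ ≤ (1 / σ ^ 2 + 2) * 1 := by gcongr
    _ = _ := mul_one _

variable {Z : Type*} [MeasurableSpace Z]

theorem solvesContinuityEq_gaussDensity {q : Measure Z} [IsProbabilityMeasure q] {σ : ℝ}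
    (hσ : 0 < σ) {m k : Z → E d} (hm : Measurable m) (hk : Measurable k) (hk2 : MemLp k 2 q) :
    SolvesContinuityEq (mixtureDensity q (gaussDensity σ 0) m k)
      (mixtureField q (gaussDensity σ 0) m k) := by
  obtain ⟨C, hC⟩ := exists_bound_fderiv_gaussDensity (d := d) hσ
  have hB : ∀ x : E d, ‖gaussDensity σ 0 x‖ ≤ (Real.sqrt (2 * Real.pi * σ ^ 2) ^ d)⁻¹ := fun x => by
    rw [Real.norm_of_nonneg (gaussDensity_nonneg _ _ _)]
    exact gaussDensity_le _ _ _
  exact solvesContinuityEq_mixture (contDiff_gaussDensity σ) hB hC (gaussDensity_pos hσ 0) hm hk hk2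

end GaussianProfile

/-! ### The marginals of flow matching are carried by the flows -/

section FlowMatching

variable {d : ℕ}

/-- For fixed `s` the center is `latentPath 0 s` plus `t` times the constant velocity `b - a`, which
is the form of a moving mixture. -/
theorem marginalDensity_eq_mixture_left (q : Measure (E d × E d × E d)) (σ t s : ℝ) (x : E d) :
    marginalDensity q σ t s x =
      mixtureDensity q (gaussDensity σ 0) (latentPath 0 s) (fun z => z.2.1 - z.1) (t, x) := by
  refine integral_congr_ae (Eventually.of_forall fun z => ?_)
  simp only [condDensity, smul_eq_mul, mul_one, shear_apply]
  rw [gaussDensity_eq_sub]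
  congr 1
  simp only [latentPath, zero_smul, add_zero]
  abel

theorem marginalDensity_eq_mixture_right (q : Measure (E d × E d × E d)) (σ t s : ℝ) (x : E d) :
    marginalDensity q σ t s x =
      mixtureDensity q (gaussDensity σ 0) (latentPath t 0) (fun z => z.2.2 - z.1) (s, x) := by
  refine integral_congr_ae (Eventually.of_forall fun z => ?_)
  simp only [condDensity, smul_eq_mul, mul_one, shear_apply]
  rw [gaussDensity_eq_sub]
  congr 1
  simp only [latentPath, zero_smul, add_zero]
  abel

theorem fieldU_eq_mixture (q : Measure (E d × E d × E d)) (σ t s : ℝ) (x : E d) :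
    fieldU q σ t s x =
      mixtureField q (gaussDensity σ 0) (latentPath 0 s) (fun z => z.2.1 - z.1) (t, x) := by
  rw [mixtureField, ← marginalDensity_eq_mixture_left, movingMixture, ← integral_smul, fieldU]
  refine integral_congr_ae (Eventually.of_forall fun z => ?_)
  simp only [condDensity, shear_apply]
  rw [gaussDensity_eq_sub, smul_smul, div_eq_inv_mul]
  congr 3
  simp only [latentPath, zero_smul, add_zero]
  abel

theorem fieldV_eq_mixture (q : Measure (E d × E d × E d)) (σ t s : ℝ) (x : E d) :
    fieldV q σ t s x =
      mixtureField q (gaussDensity σ 0) (latentPath t 0) (fun z => z.2.2 - z.1) (s, x) := by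
  rw [mixtureField, ← marginalDensity_eq_mixture_right, movingMixture, ← integral_smul, fieldV]
  refine integral_congr_ae (Eventually.of_forall fun z => ?_)
  simp only [condDensity, shear_apply]
  rw [gaussDensity_eq_sub, smul_smul, div_eq_inv_mul]
  congr 3
  simp only [latentPath, zero_smul, add_zero]
  abel

variable {q : Measure (E d × E d × E d)} [IsProbabilityMeasure q] {σ : ℝ}

/-- Following the field `u` carries the marginals along in the `t`-direction. -/
theorem map_flow_fieldU (hσ : 0 < σ) (hq : MemLp (fun z : E d × E d × E d => z.2.1 - z.1) 2 q)
    {s : ℝ} {μ : Measure (E d)} {X : ℝ → E d → E d} (hX0 : AEMeasurable (X 0) μ)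
    (hμ : μ.map (X 0) = marginal q σ 0 s)
    (hX : ∀ᵐ a ∂μ, ∀ τ ∈ Icc (0 : ℝ) 1,
      HasDerivWithinAt (fun τ => X τ a) (fieldU q σ τ s (X τ a)) (Icc 0 1) τ)
    {t : ℝ} (ht : t ∈ Icc (0 : ℝ) 1) :
    AEMeasurable (X t) μ ∧ μ.map (X t) = marginal q σ t s := by
  have hc := solvesContinuityEq_gaussDensity (q := q) hσ (measurable_latentPath (d := d) 0 s)
    (by fun_prop) hq
  have hdens : ∀ t, densityMeasure (mixtureDensity q (gaussDensity σ 0) (latentPath 0 s)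
      fun z => z.2.1 - z.1) t = marginal q σ t s := fun t => by
    simp only [densityMeasure, marginal, ← marginalDensity_eq_mixture_left]
  simp only [fieldU_eq_mixture] at hX
  refine ⟨hc.aemeasurable_of_ae_hasDerivWithinAt hX0 hX ht, ?_⟩
  rw [hc.map_eq (fun t => by rw [hdens]; exact isProbabilityMeasure_marginal q hσ t s) hX0
    (by rw [hdens, hμ]) hX ht, hdens]

/-- Following the field `v` carries the marginals along in the `s`-direction. -/
theorem map_flow_fieldV (hσ : 0 < σ) (hq : MemLp (fun z : E d × E d × E d => z.2.2 - z.1) 2 q)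
    {t : ℝ} {μ : Measure (E d)} {X : ℝ → E d → E d} (hX0 : AEMeasurable (X 0) μ)
    (hμ : μ.map (X 0) = marginal q σ t 0)
    (hX : ∀ᵐ a ∂μ, ∀ τ ∈ Icc (0 : ℝ) 1,
      HasDerivWithinAt (fun τ => X τ a) (fieldV q σ t τ (X τ a)) (Icc 0 1) τ)
    {s : ℝ} (hs : s ∈ Icc (0 : ℝ) 1) :
    AEMeasurable (X s) μ ∧ μ.map (X s) = marginal q σ t s := by
  have hc := solvesContinuityEq_gaussDensity (q := q) hσ (measurable_latentPath (d := d) t 0)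
    (by fun_prop) hq
  have hdens : ∀ s, densityMeasure (mixtureDensity q (gaussDensity σ 0) (latentPath t 0)
      fun z => z.2.2 - z.1) s = marginal q σ t s := fun s => by
    simp only [densityMeasure, marginal, ← marginalDensity_eq_mixture_right]
  simp only [fieldV_eq_mixture] at hX
  refine ⟨hc.aemeasurable_of_ae_hasDerivWithinAt hX0 hX hs, ?_⟩
  rw [hc.map_eq (fun s => by rw [hdens]; exact isProbabilityMeasure_marginal q hσ t s) hX0
    (by rw [hdens, hμ]) hX hs, hdens]

/-- Each flow is transported along its two legs: along an axis from the identity, and then in the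
other direction. The law and almost everywhere measurability found at the end of the first leg are
the initial data of the second. -/
theorem IsFlowPair.map_eq_marginal (hσ : 0 < σ)
    (hq₁ : MemLp (fun z : E d × E d × E d => z.2.1 - z.1) 2 q)
    (hq₂ : MemLp (fun z : E d × E d × E d => z.2.2 - z.1) 2 q) {Φ Ψ : ℝ → ℝ → E d → E d}
    (h : IsFlowPair (fieldU q σ) (fieldV q σ) (marginal q σ 0 0) Φ Ψ) {t s : ℝ}
    (ht : t ∈ Icc (0 : ℝ) 1) (hs : s ∈ Icc (0 : ℝ) 1) :
    (marginal q σ 0 0).map (Φ t s) = marginal q σ t s ∧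
      (marginal q σ 0 0).map (Ψ t s) = marginal q σ t s := by
  have h01 : (0 : ℝ) ∈ Icc (0 : ℝ) 1 := by simp
  have hΦ0 : Φ 0 0 = id := funext h.Φ_zero
  have hΨ0 : Ψ 0 0 = id := funext h.Ψ_zero
  constructor
  · have h1 := map_flow_fieldV hσ hq₂ (t := 0) (X := fun s => Ψ 0 s)
      (by simp only [hΨ0]; exact aemeasurable_id) (by simp only [hΨ0]; exact Measure.map_id)
      (h.Ψ_ode 0 h01) hs
    have h2 : Φ 0 s = Ψ 0 s := funext (h.Φ_init s hs)
    exact (map_flow_fieldU hσ hq₁ (s := s) (X := fun t => Φ t s) (by simp only [h2]; exact h1.1)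
      (by simp only [h2]; exact h1.2) (h.Φ_ode s hs) ht).2
  · have h1 := map_flow_fieldU hσ hq₁ (s := 0) (X := fun t => Φ t 0)
      (by simp only [hΦ0]; exact aemeasurable_id) (by simp only [hΦ0]; exact Measure.map_id)
      (h.Φ_ode 0 h01) ht
    have h2 : Ψ t 0 = Φ t 0 := funext (h.Ψ_init t ht)
    exact (map_flow_fieldV hσ hq₂ (t := t) (X := fun s => Ψ t s) (by simp only [h2]; exact h1.1)
      (by simp only [h2]; exact h1.2) (h.Ψ_ode t ht) hs).2

end FlowMatching

/-! ### Simultaneous pairwise optimality of an admissible family -/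

section Admissible

variable {d : ℕ} {ι : Type*} {μ : Measure (E d)} {Ω : Set (E d)} {T : ι → E d → E d}

/-- The members of an admissible family couple their images optimally, pair by pair. -/
theorem IsAdmissibleFamily.lintegral_edist_sq_eq (hT : IsAdmissibleFamily μ Ω T)
    (hΩ : μ Ωᶜ = 0) (i j : ι) :
    ∫⁻ a, edist (T i a) (T j a) ^ 2 ∂μ = W2sq (μ.map (T i)) (μ.map (T j)) := by
  -- The optimal map goes from the image of `T i` to that of `T j`. At `T i a` with `a ∈ Ω` its
  -- value is `T j a`, by injectivity of `T i` on `Ω`.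
  have hopt := hT.optimal j i
  have hm : AEMeasurable (fun x => edist x ((T j ∘ Function.invFunOn (T i) Ω) x) ^ 2)
      (μ.map (T i)) := (aemeasurable_id.edist hopt.aemeasurable).pow_const 2
  rw [← hopt.cost_eq, lintegral_map' hm (hT.aemeasurable i)]
  refine lintegral_congr_ae ?_
  have hmem : ∀ᵐ a ∂μ, a ∈ Ω := by rw [ae_iff]; exact hΩ
  filter_upwards [hmem] with a ha
  have hinv : Function.invFunOn (T i) Ω (T i a) = a := (hT.bijOn i).injOn.leftInvOn_invFunOn ha
  simp only [Function.comp_apply, hinv]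

variable {κ : Type*} {ρ : κ → Measure (E d)} {j : κ → ι}

theorem IsAdmissibleFamily.map_mem_multiCouplings [Fintype κ] (hT : IsAdmissibleFamily μ Ω T)
    (hρ : ∀ i, μ.map (T (j i)) = ρ i) :
    μ.map (fun a i => T (j i) a) ∈ multiCouplings ρ := by
  have hm : AEMeasurable (fun a (i : κ) => T (j i) a) μ :=
    aemeasurable_pi_lambda _ fun i => hT.aemeasurable (j i)
  intro i
  rw [AEMeasurable.map_map_of_aemeasurable (measurable_pi_apply i).aemeasurable hm, ← hρ i]
  rfl

theorem IsAdmissibleFamily.planCost_pairMarginal_map [Fintype κ] (hT : IsAdmissibleFamily μ Ω T)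
    (hΩ : μ Ωᶜ = 0) (hρ : ∀ i, μ.map (T (j i)) = ρ i) (i k : κ) :
    planCost (pairMarginal (μ.map fun a i => T (j i) a) i k) = W2sq (ρ i) (ρ k) := by
  have hm : AEMeasurable (fun a (i : κ) => T (j i) a) μ :=
    aemeasurable_pi_lambda _ fun i => hT.aemeasurable (j i)
  rw [planCost_pairMarginal, lintegral_map' (measurable_edist_apply_sq i k).aemeasurable hm,
    hT.lintegral_edist_sq_eq hΩ, hρ, hρ]

end Admissible

/-! ### The latent law of `(a, T₁ a, T₂ a)` -/

section LatentCoupling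

variable {d : ℕ} {ρ₀ : Measure (E d)} {T₁ T₂ : E d → E d}

theorem aemeasurable_latent (h₁ : AEMeasurable T₁ ρ₀) (h₂ : AEMeasurable T₂ ρ₀) :
    AEMeasurable (fun a => (a, T₁ a, T₂ a)) ρ₀ :=
  aemeasurable_id'.prodMk (h₁.prodMk h₂)

theorem map_latentPath_mapCoupling (h₁ : AEMeasurable T₁ ρ₀) (h₂ : AEMeasurable T₂ ρ₀) (t s : ℝ) :
    (mapCoupling ρ₀ T₁ T₂).map (latentPath t s) = ρ₀.map (zPath T₁ T₂ t s) := by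
  rw [mapCoupling, AEMeasurable.map_map_of_aemeasurable (measurable_latentPath t s).aemeasurable
    (aemeasurable_latent h₁ h₂)]
  congr 1
  funext a
  simp only [Function.comp_apply, latentPath, zPath, smul_sub, sub_smul, one_smul]
  abel

theorem memLp_mapCoupling_iff (h₁ : AEMeasurable T₁ ρ₀) (h₂ : AEMeasurable T₂ ρ₀)
    {f : E d × E d × E d → E d} (hf : Measurable f) :
    MemLp f 2 (mapCoupling ρ₀ T₁ T₂) ↔ MemLp (fun a => f (a, T₁ a, T₂ a)) 2 ρ₀ :=
  memLp_map_measure_iff hf.aestronglyMeasurable (aemeasurable_latent h₁ h₂)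

theorem zPath_zero_zero : zPath T₁ T₂ 0 0 = id := by
  funext a; simp [zPath]

theorem IsOptimalTransportMap.memLp {T : E d → E d} {μ ν : Measure (E d)}
    (h : IsOptimalTransportMap T μ ν) (hν : MemLp id 2 ν) : MemLp T 2 μ := by
  rw [← h.map_eq, memLp_map_measure_iff aestronglyMeasurable_id h.aemeasurable] at hν
  exact hν

end LatentCoupling

end PiFM

/-! ### The main theorem -/

theorem theorem2 {d : ℕ} (ρ₀ ρ₁ ρ₂ : MeasureTheory.Measure (PiFM.E d))
    [IsProbabilityMeasure ρ₀] [IsProbabilityMeasure ρ₁] [IsProbabilityMeasure ρ₂]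
    (hρ₀ : MemLp id 2 ρ₀) (hρ₁ : MemLp id 2 ρ₁) (hρ₂ : MemLp id 2 ρ₂)
    -- an admissible family of deformations of a domain that carries `ρ₀`
    (Ω : Set (PiFM.E d)) (hΩ : MeasurableSet Ω) (hρ₀Ω : ρ₀ Ωᶜ = 0)
    {ι : Type*} (T : ι → PiFM.E d → PiFM.E d) (hT : PiFM.IsAdmissibleFamily ρ₀ Ω T)
    -- two members of the family, optimal from `ρ₀` to `ρ₁` and from `ρ₀` to `ρ₂`
    (T₁ T₂ : PiFM.E d → PiFM.E d) (hT₁ : T₁ ∈ Set.range T) (hT₂ : T₂ ∈ Set.range T)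
    (hopt₁ : PiFM.IsOptimalTransportMap T₁ ρ₀ ρ₁)
    (hopt₂ : PiFM.IsOptimalTransportMap T₂ ρ₀ ρ₂)
    (t s : ℝ) (ht : 0 ≤ t) (hs : 0 ≤ s) (hts : t + s ≤ 1) :
    -- for `σ > 0` both flows carry the initial marginal to the marginal at `(t, s)`
    (∀ σ : ℝ, 0 < σ → ∀ Φ Ψ : ℝ → ℝ → PiFM.E d → PiFM.E d,
      PiFM.IsFlowPair (PiFM.fieldU (PiFM.mapCoupling ρ₀ T₁ T₂) σ)
        (PiFM.fieldV (PiFM.mapCoupling ρ₀ T₁ T₂) σ)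
        (PiFM.marginal (PiFM.mapCoupling ρ₀ T₁ T₂) σ 0 0) Φ Ψ →
      (PiFM.marginal (PiFM.mapCoupling ρ₀ T₁ T₂) σ 0 0).map (Φ t s) =
          PiFM.marginal (PiFM.mapCoupling ρ₀ T₁ T₂) σ t s ∧
        (PiFM.marginal (PiFM.mapCoupling ρ₀ T₁ T₂) σ 0 0).map (Ψ t s) =
          PiFM.marginal (PiFM.mapCoupling ρ₀ T₁ T₂) σ t s) ∧
    -- as `σ → 0` the initial marginal converges weakly to `ρ₀`,
    -- and the marginal at `(t, s)` to the law of `z_{t,s}`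
    (∀ f : PiFM.E d →ᵇ ℝ,
      Tendsto (fun σ : ℝ => ∫ x, f x ∂(PiFM.marginal (PiFM.mapCoupling ρ₀ T₁ T₂) σ 0 0))
          (𝓝[>] 0) (𝓝 (∫ x, f x ∂ρ₀)) ∧
        Tendsto (fun σ : ℝ => ∫ x, f x ∂(PiFM.marginal (PiFM.mapCoupling ρ₀ T₁ T₂) σ t s))
          (𝓝[>] 0) (𝓝 (∫ x, f x ∂(ρ₀.map (PiFM.zPath T₁ T₂ t s))))) ∧
    -- this limit is a Wasserstein barycenter, in both descriptions
    PiFM.IsWassersteinBarycenter ![1 - t - s, t, s] ![ρ₀, ρ₁, ρ₂]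
      (ρ₀.map (PiFM.zPath T₁ T₂ t s)) ∧
    PiFM.IsMultiMarginalBarycenter ![1 - t - s, t, s] ![ρ₀, ρ₁, ρ₂]
      (ρ₀.map (PiFM.zPath T₁ T₂ t s)) ∧
    -- it is the only one as soon as a measure of positive weight is absolutely continuous
    ((∃ j : Fin 3, 0 < (![1 - t - s, t, s] : Fin 3 → ℝ) j ∧
        (![ρ₀, ρ₁, ρ₂] : Fin 3 → MeasureTheory.Measure (PiFM.E d)) j ≪ volume) →
      ∀ ν : MeasureTheory.Measure (PiFM.E d),
        (PiFM.IsWassersteinBarycenter ![1 - t - s, t, s] ![ρ₀, ρ₁, ρ₂] ν ∨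
          PiFM.IsMultiMarginalBarycenter ![1 - t - s, t, s] ![ρ₀, ρ₁, ρ₂] ν) →
        ν = ρ₀.map (PiFM.zPath T₁ T₂ t s)) ∧
    -- the optimal multi-marginal transport cost
    Integrable (fun a => (1 - t - s) * ‖PiFM.zPath T₁ T₂ t s a - a‖ ^ 2
      + t * ‖PiFM.zPath T₁ T₂ t s a - T₁ a‖ ^ 2
      + s * ‖PiFM.zPath T₁ T₂ t s a - T₂ a‖ ^ 2) ρ₀ ∧
    IsLeast (PiFM.multiMarginalCost ![1 - t - s, t, s] ''
        PiFM.multiCouplings ![ρ₀, ρ₁, ρ₂])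
      (ENNReal.ofReal (∫ a, ((1 - t - s) * ‖PiFM.zPath T₁ T₂ t s a - a‖ ^ 2
        + t * ‖PiFM.zPath T₁ T₂ t s a - T₁ a‖ ^ 2
        + s * ‖PiFM.zPath T₁ T₂ t s a - T₂ a‖ ^ 2) ∂ρ₀)) := by
  have hm₁ := hopt₁.aemeasurable
  have hm₂ := hopt₂.aemeasurable
  have hL₁ := hopt₁.memLp hρ₁
  have hL₂ := hopt₂.memLp hρ₂
  have hL₀ : MemLp (fun a => a) 2 ρ₀ := hρ₀
  have hq : IsProbabilityMeasure (PiFM.mapCoupling ρ₀ T₁ T₂) :=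
    Measure.isProbabilityMeasure_map (PiFM.aemeasurable_latent hm₁ hm₂)
  have hq₁ : MemLp (fun z : PiFM.E d × PiFM.E d × PiFM.E d => z.2.1 - z.1) 2
      (PiFM.mapCoupling ρ₀ T₁ T₂) :=
    (PiFM.memLp_mapCoupling_iff hm₁ hm₂ (by fun_prop)).2 (hL₁.sub hL₀)
  have hq₂ : MemLp (fun z : PiFM.E d × PiFM.E d × PiFM.E d => z.2.2 - z.1) 2
      (PiFM.mapCoupling ρ₀ T₁ T₂) :=
    (PiFM.memLp_mapCoupling_iff hm₁ hm₂ (by fun_prop)).2 (hL₂.sub hL₀)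
  have htI : t ∈ Icc (0 : ℝ) 1 := ⟨ht, by linarith⟩
  have hsI : s ∈ Icc (0 : ℝ) 1 := ⟨hs, by linarith⟩
  have hmem : ∀ᵐ a ∂ρ₀, a ∈ Ω := by rw [ae_iff]; exact hρ₀Ω
  obtain ⟨j₀, hj₀⟩ := hT.exists_id
  obtain ⟨j₁, rfl⟩ := hT₁
  obtain ⟨j₂, rfl⟩ := hT₂
  set w : Fin 3 → ℝ := ![1 - t - s, t, s] with hw
  set ρ : Fin 3 → MeasureTheory.Measure (PiFM.E d) := ![ρ₀, ρ₁, ρ₂] with hρdef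
  -- The identity member is included so that `ρ₀` too is the image of `ρ₀` under a map of the
  -- family. All three pairs are then covered by admissibility.
  let j : Fin 3 → ι := ![j₀, j₁, j₂]
  have hw0 : ∀ i, 0 ≤ w i := by
    intro i; fin_cases i
    · change 0 ≤ 1 - t - s; linarith
    · exact ht
    · exact hs
  have hw1 : ∑ i, w i = 1 := by
    rw [Fin.sum_univ_three]; change 1 - t - s + t + s = 1; ring
  have hprob : ∀ i, IsProbabilityMeasure (ρ i) := by
    intro i; fin_cases i
    · exact ‹IsProbabilityMeasure ρ₀›
    · exact ‹IsProbabilityMeasure ρ₁›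
    · exact ‹IsProbabilityMeasure ρ₂›
  have hρL : ∀ i, MemLp id 2 (ρ i) := by
    intro i; fin_cases i
    · exact hρ₀
    · exact hρ₁
    · exact hρ₂
  have hid : ∀ᵐ a ∂ρ₀, T j₀ a = a := hmem.mono fun a ha => hj₀ ha
  have hmap : ∀ i, ρ₀.map (T (j i)) = ρ i := by
    intro i; fin_cases i
    · exact (Measure.map_congr hid).trans Measure.map_id
    · exact hopt₁.map_eq
    · exact hopt₂.map_eq
  set γ₀ : MeasureTheory.Measure (Fin 3 → PiFM.E d) := ρ₀.map fun a i => T (j i) a with hγ₀def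
  have hTm : AEMeasurable (fun a (i : Fin 3) => T (j i) a) ρ₀ :=
    aemeasurable_pi_lambda _ fun i => hT.aemeasurable (j i)
  have hγ₀ : γ₀ ∈ PiFM.multiCouplings ρ := hT.map_mem_multiCouplings hmap
  have hopt := hT.planCost_pairMarginal_map hρ₀Ω hmap
  have hbary : ∀ᵐ a ∂ρ₀, PiFM.baryMap w (fun i => T (j i) a) = PiFM.zPath (T j₁) (T j₂) t s a := by
    filter_upwards [hid] with a ha
    rw [PiFM.baryMap, Fin.sum_univ_three]
    change (1 - t - s) • T j₀ a + t • T j₁ a + s • T j₂ a = _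
    rw [ha, PiFM.zPath]
  have hlaw : γ₀.map (PiFM.baryMap w) = ρ₀.map (PiFM.zPath (T j₁) (T j₂) t s) := by
    rw [hγ₀def, AEMeasurable.map_map_of_aemeasurable
      (PiFM.measurable_baryMap w).aemeasurable hTm]
    exact Measure.map_congr hbary
  have hzL : MemLp (PiFM.zPath (T j₁) (T j₂) t s) 2 ρ₀ :=
    ((hL₀.const_smul (1 - t - s)).add (hL₁.const_smul t)).add (hL₂.const_smul s)
  have hint : Integrable (fun a => (1 - t - s) * ‖PiFM.zPath (T j₁) (T j₂) t s a - a‖ ^ 2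
      + t * ‖PiFM.zPath (T j₁) (T j₂) t s a - T j₁ a‖ ^ 2
      + s * ‖PiFM.zPath (T j₁) (T j₂) t s a - T j₂ a‖ ^ 2) ρ₀ :=
    ((((hzL.sub hL₀).integrable_norm_pow two_ne_zero).const_mul _).add
      (((hzL.sub hL₁).integrable_norm_pow two_ne_zero).const_mul _)).add
      (((hzL.sub hL₂).integrable_norm_pow two_ne_zero).const_mul _)
  have hcost : PiFM.multiMarginalCost w γ₀ = ENNReal.ofReal (∫ a,
      ((1 - t - s) * ‖PiFM.zPath (T j₁) (T j₂) t s a - a‖ ^ 2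
        + t * ‖PiFM.zPath (T j₁) (T j₂) t s a - T j₁ a‖ ^ 2
        + s * ‖PiFM.zPath (T j₁) (T j₂) t s a - T j₂ a‖ ^ 2) ∂ρ₀) := by
    have hbm := PiFM.measurable_baryMap (d := d) w
    rw [ofReal_integral_eq_lintegral_ofReal hint (Eventually.of_forall fun a =>
        add_nonneg (add_nonneg (mul_nonneg (by linarith) (by positivity)) (by positivity))
          (by positivity)), PiFM.multiMarginalCost, hγ₀def, lintegral_map' _ hTm]
    · refine lintegral_congr_ae ?_
      filter_upwards [hbary, hid] with a ha ha0
      simp only [ha]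
      rw [Fin.sum_univ_three]
      change ENNReal.ofReal ((1 - t - s) * ‖_ - T j₀ a‖ ^ 2 + t * ‖_ - T j₁ a‖ ^ 2 +
        s * ‖_ - T j₂ a‖ ^ 2) = _
      rw [ha0]
    · exact Measurable.aemeasurable (by fun_prop)
  have hmult := PiFM.isMultiMarginalBarycenter_of_pairwise_optimal hw0 hw1 hγ₀ hopt
  have hwass := PiFM.isWassersteinBarycenter_of_pairwise_optimal hw0 hw1 hρL hγ₀ hopt
  rw [hlaw] at hmult hwass
  refine ⟨fun σ hσ Φ Ψ hΦΨ => hΦΨ.map_eq_marginal hσ hq₁ hq₂ htI hsI, fun f => ⟨?_, ?_⟩, hwass,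
    hmult, ?_, hint, ?_, ?_⟩
  · have h := PiFM.tendsto_integral_marginal (PiFM.mapCoupling ρ₀ (T j₁) (T j₂)) 0 0 f
    rwa [PiFM.map_latentPath_mapCoupling hm₁ hm₂, PiFM.zPath_zero_zero, Measure.map_id] at h
  · have h := PiFM.tendsto_integral_marginal (PiFM.mapCoupling ρ₀ (T j₁) (T j₂)) t s f
    rwa [PiFM.map_latentPath_mapCoupling hm₁ hm₂] at h
  · rintro ⟨k, hk, hac⟩ ν hν
    -- The absolutely continuous marginal need not be `ρ₀`; admissibility provides optimal maps out
    -- of any of the three.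
    have hS : ∀ i, PiFM.IsOptimalTransportMap
        (T (j i) ∘ Function.invFunOn (T (j k)) Ω) (ρ k) (ρ i) := fun i => by
      rw [← hmap i, ← hmap k]
      exact hT.optimal (j i) (j k)
    have hν' : PiFM.IsMultiMarginalBarycenter w ρ ν :=
      hν.elim (fun h => h.isMultiMarginalBarycenter hw0 hw1 hρL hγ₀ hopt) id
    rw [hν'.eq_of_absolutelyContinuous hw0 hw1 hρL hγ₀ hopt hk hac hS, hlaw]
  · exact ⟨γ₀, hγ₀, hcost⟩
  · rintro _ ⟨γ, hγ, rfl⟩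
    rw [← hcost]
    exact PiFM.multiMarginalCost_le_of_pairwise_optimal hw0 hw1 hopt hγ
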